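/- Let $d\ge 1$, $\rho\ge 0$ and $\alpha\in(0,d/2)$ with $2(\alpha+1)>d$ (Dalang's condition). Identify the torus with $\mathbb{T}^d=[-\pi,\pi]^d$ and, for $x\in\mathbb{R}^d$, let $[x]\in[-\pi,\pi)^d$ be the coordinatewise reduction of $x$ modulo $2\pi$. With $p(t,x)=(2\pi t)^{-1/2}e^{-x^2/(2t)}$ put $$G(t,x)=\sum_{k\in\mathbb{Z}^d}\prod_{i=1}^d p(t,x_i+2\pi k_i),\qquad f_{\alpha,\rho}(x)=\frac{\rho}{(2\pi)^d}+\frac1{\Gamma(\alpha)}\int_0^\infty t^{\alpha-1}\Big(G(t,x)-\frac1{(2\pi)^d}\Big)dt,$$ and $G(t,x,y)=G(t,[x-y])$, $f_{\alpha,\rho}(x,y)=f_{\alpha,\rho}([x-y])$. Let $\mathcal{F}(\varphi)(k)=(2\pi)^{-d/2}\int_{\mathbb{T}^d}\varphi(x)e^{-ik\cdot x}dx$ for $k\in\mathbb{Z}^d$, and $$k_1(s)=\sum_{k\in\mathbb{Z}^d}\mathcal{F}(f_{\alpha,\rho})(k)\,e^{-s|k|^2},\qquad k_2(s)=\int_{\mathbb{R}^d}c_{d,\alpha}|\xi|^{-2\alpha}e^{-s|\xi|^2/2}\,d\xi,\qquad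 c_{d,\alpha}=\frac{2^{2\alpha-d/2}\,\Gamma(\alpha)}{\Gamma(d/2-\alpha)},$$ where $c_{d,\alpha}|\xi|^{-2\alpha}$ is the Fourier transform of the Riesz kernel $|x|^{-d+2\alpha}$ on $\mathbb{R}^d$ (normalized by $(2\pi)^{-d/2}$). Define $h_0(t)=1$, $h_{n+1}(t)=\int_0^t h_n(t-s)\,(k_1(s)+k_2(s)+1)\,ds$ for $n\ge0$, and $H_\lambda(t)=\sum_{n\ge0}\lambda^{2n}h_n(t)$. Define $\mathcal{L}_0(t,x_0,x,x_0',x')=G(t,x_0,x)G(t,x_0',x')$ and, for $n\ge1$, $$\mathcal{L}_n(t,x_0,x,x_0',x')=\int_0^t ds\iint_{\mathbb{T}^{2d}}dz\,dz'\;\mathcal{L}_0(t-s,z,x,z',x')\,\mathcal{L}_{n-1}(s,x_0,z,x_0',z')\,f_{\alpha,\rho}(z,z'),$$ and $\mathcal{K}_\lambda=\sum_{n\ge0}\lambda^{2n}\mathcal{L}_n$ for $\lambda\neq0$. Then there is a constant $C=C_{\alpha,\rho,d}>0$ such that for all $t>0$, all $x_0,x,x_0',x'\in\mathbb{T}^d$,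 all real $\lambda\ne0$ and all $n\ge1$: the integrals defining $\mathcal{L}_n(t,x_0,x,x_0',x')$ (jointly in $(s,z,z')$) and $h_n(t)$ converge absolutely and $$|\mathcal{L}_n(t,x_0,x,x_0',x')|\le C^n\,G(t,x_0,x)\,G(t,x_0',x')\,h_n(t);$$ and, with $C_*=\lambda C^{1/2}$, the series defining $\mathcal{K}_\lambda(t,x_0,x,x_0',x')$ and $H_{C_*}(t)$ converge absolutely and $$|\mathcal{K}_\lambda(t,x_0,x,x_0',x')|\le G(t,x_0,x)\,G(t,x_0',x')\,H_{C_*}(t)<\infty.$$ -/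

import Mathlib

open MeasureTheory Set

namespace TorusPAM

noncomputable section

/-- The fundamental cube `[-π, π]^d` representing the flat torus. -/
def torus (d : ℕ) : Set (Fin d → ℝ) :=
  Set.Icc (fun _ => -Real.pi) (fun _ => Real.pi)

/-- The coordinatewise signed remainder `mod (x i + π, 2π) - π`, with values in `[-π, π)`. -/
def wrap {d : ℕ} (x : Fin d → ℝ) : Fin d → ℝ :=
  fun i => toIcoMod Real.two_pi_pos (-Real.pi) (x i)

/-- The heat kernel `p(t,x) = (2πt)^{-1/2} exp(-x²/(2t))` on the real line. -/
def gaussKernel (t x : ℝ) : ℝ :=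
  (Real.sqrt (2 * Real.pi * t))⁻¹ * Real.exp (-x ^ 2 / (2 * t))

/-- The heat kernel `G(t,x)` on the `d`-dimensional torus. -/
def heat {d : ℕ} (t : ℝ) (x : Fin d → ℝ) : ℝ :=
  ∑' k : Fin d → ℤ, ∏ i, gaussKernel t (x i + 2 * Real.pi * (k i : ℝ))

/-- The two-point heat kernel `G(t,x,y)`. -/
def heat₂ {d : ℕ} (t : ℝ) (x y : Fin d → ℝ) : ℝ :=
  heat t (wrap (x - y))

/-- The spatial covariance function `f_{α,ρ}(x)` of the coloured noise. -/
def cov {d : ℕ} (α ρ : ℝ) (x : Fin d → ℝ) : ℝ :=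
  ρ / (2 * Real.pi) ^ d +
    1 / Real.Gamma α *
      ∫ t in Set.Ioi (0 : ℝ), t ^ (α - 1) * (heat t x - 1 / (2 * Real.pi) ^ d)

/-- The two-point covariance `f_{α,ρ}(x,y)`. -/
def cov₂ {d : ℕ} (α ρ : ℝ) (x y : Fin d → ℝ) : ℝ :=
  cov α ρ (wrap (x - y))

/-- The Fourier coefficients `(2π)^{-d/2} ∫ φ(x) exp(-i k·x) dx` of a function on the torus. -/
def fourierCoeffTorus {d : ℕ} (φ : (Fin d → ℝ) → ℝ) (k : Fin d → ℤ) : ℂ :=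
  (((2 * Real.pi) ^ (-(d : ℝ) / 2) : ℝ) : ℂ) *
    ∫ x in torus d, (φ x : ℂ) *
      Complex.exp (-(Complex.I * ((∑ i, (k i : ℝ) * x i : ℝ) : ℂ)))

/-- `k₁(s) = ∑_k 𝓕(f_{α,ρ})(k) exp(-s|k|²)`. The covariance is even, so its Fourier
coefficients are real numbers and `.re` only changes the type. -/
def k₁ (d : ℕ) (α ρ s : ℝ) : ℝ :=
  ∑' k : Fin d → ℤ,
    (fourierCoeffTorus (cov α ρ) k).re * Real.exp (-s * ∑ i, (k i : ℝ) ^ 2)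

/-- The Fourier transform `c_{d,α} |ξ|^{-2α}` of the Riesz kernel `|x|^{-d+2α}` on `ℝ^d`
(`0 < α < d/2`), for the convention `(2π)^{-d/2} ∫ φ(x) exp(-i ξ·x) dx`. -/
def rieszFourier (d : ℕ) (α : ℝ) (ξ : EuclideanSpace ℝ (Fin d)) : ℝ :=
  2 ^ (2 * α - (d : ℝ) / 2) * Real.Gamma α / Real.Gamma ((d : ℝ) / 2 - α) *
    ‖ξ‖ ^ (-2 * α)

/-- `k₂(s) = ∫ (Fourier transform of the Riesz kernel)(ξ) exp(-s|ξ|²/2) dξ`. -/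
def k₂ (d : ℕ) (α s : ℝ) : ℝ :=
  ∫ ξ : EuclideanSpace ℝ (Fin d), rieszFourier d α ξ * Real.exp (-(s * ‖ξ‖ ^ 2 / 2))

/-- `h₀ = 1` and `h_{n+1}(t) = ∫_0^t h_n(t-s) (k₁(s) + k₂(s) + 1) ds`. -/
def h (d : ℕ) (α ρ : ℝ) : ℕ → ℝ → ℝ
  | 0, _ => 1
  | n + 1, t => ∫ s in (0 : ℝ)..t, h d α ρ n (t - s) * (k₁ d α ρ s + k₂ d α s + 1)

/-- `H_l(t) = ∑_n l^{2n} h_n(t)`. -/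
def H (d : ℕ) (α ρ l t : ℝ) : ℝ :=
  ∑' n : ℕ, l ^ (2 * n) * h d α ρ n t

/-- Functions of `(t, x₀, x, x₀', x')`. -/
abbrev Kernel4 (d : ℕ) : Type :=
  ℝ → (Fin d → ℝ) → (Fin d → ℝ) → (Fin d → ℝ) → (Fin d → ℝ) → ℝ

/-- The integrand, as a function of `(s, (z, z'))`, of the space-time convolution. -/
def convIntegrand {d : ℕ} (α ρ : ℝ) (u w : Kernel4 d) (t : ℝ) (x₀ x x₀' x' : Fin d → ℝ)
    (q : ℝ × ((Fin d → ℝ) × (Fin d → ℝ))) : ℝ :=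
  u (t - q.1) q.2.1 x q.2.2 x' * w q.1 x₀ q.2.1 x₀' q.2.2 * cov₂ α ρ q.2.1 q.2.2

/-- The space-time convolution `u ▷ w`. -/
def conv {d : ℕ} (α ρ : ℝ) (u w : Kernel4 d) : Kernel4 d :=
  fun t x₀ x x₀' x' =>
    ∫ s in (0 : ℝ)..t, ∫ z in torus d ×ˢ torus d, convIntegrand α ρ u w t x₀ x x₀' x' (s, z)

/-- `𝓛₀(t,x₀,x,x₀',x') = G(t,x₀,x) G(t,x₀',x')`. -/
def L₀ (d : ℕ) : Kernel4 d :=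
  fun t x₀ x x₀' x' => heat₂ t x₀ x * heat₂ t x₀' x'

/-- The iterated kernels `𝓛_n = 𝓛₀ ▷ 𝓛_{n-1}`. -/
def L (d : ℕ) (α ρ : ℝ) : ℕ → Kernel4 d
  | 0 => L₀ d
  | n + 1 => conv α ρ (L₀ d) (L d α ρ n)

/-- The resolvent `𝓚_l = ∑_n l^{2n} 𝓛_n`. -/
def K (d : ℕ) (α ρ l : ℝ) : Kernel4 d :=
  fun t x₀ x x₀' x' => ∑' n : ℕ, l ^ (2 * n) * L d α ρ n t x₀ x x₀' x'

end

end TorusPAM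

namespace TorusPAM

/-! ### The one-dimensional heat kernel -/

/-! The engine is the Brownian bridge. A product of Gaussians p(t-s,a)p(s,b) equals p(t,a+b) times a
Gaussian of variance σ = s(t-s)/t, and summing over periodic images turns this into `eheat_mul`: as
a function of z, G(t-s,z,x)G(s,x₀,z) is a mixture of torus heat kernels at time σ whose total weight
is G(t,x₀,x). In each convolution the factor G(t,x₀,x)G(t,x₀',x') therefore comes out, and what
remains is the average of |f| over two independent bridges (`lintegral_bridge_le`).

That average is at most a constant times 1 + σ^(α-d/2), uniformly in the centres
(`exists_lintegral_eheat_mul_cov₂_le`). Indeed f is a time integral of heat kernels, so smoothing it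
replaces G(t) by G(σ+t); this is at most a constant plus a multiple of (σ+t)^(-d/2), and integrating
against t^(α-1) gives σ^(α-d/2). The heat kernel bound comes from the theta function, by Jacobi
inversion at small times and exponential decay at large ones.

The weight in the recursion for `h` has the same size: k₂(s) is exactly a multiple of s^(α-d/2) by
scaling, k₁ is nonnegative and bounded by the same profile, so k₁+k₂+1 is comparable to 1 +
s^(α-d/2) (`exists_weight_bounds`). Because 1/σ = 1/s + 1/(t-s), the singularity in σ splits into
one at each endpoint, and monotonicity of h_n moves the one at s = 0 to where the recursion expects
it (`exists_lintegral_h_mul_le`). Induction on n then gives the bound on `L`.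

For the series, Dalang's condition makes the weight locally integrable with Laplace transform
tending to 0, so h_n(t) ≤ e^(γt) κ^n for every κ > 0 with a suitable γ (`exists_h_le`). All coupling
strengths are thus covered. Estimates are made with extended nonnegative integrals, so one bound
yields both absolute convergence and the size of the kernel. -/

lemma gaussKernel_nonneg (t x : ℝ) : 0 ≤ gaussKernel t x := by
  unfold gaussKernel; positivity

lemma measurable_gaussKernel : Measurable (fun p : ℝ × ℝ => gaussKernel p.1 p.2) := by
  unfold gaussKernel; fun_prop

/-- The periodised Gaussian on the line, as an extended nonnegative real. -/
noncomputable def circleHeat (t x : ℝ) : ENNReal :=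
  ∑' k : ℤ, ENNReal.ofReal (gaussKernel t (x + 2 * Real.pi * k))

/-! ### Theta series, Poisson summation and the circle heat kernel -/

/-- The theta series `∑ exp (-u n²)`. -/
noncomputable def theta (u : ℝ) : ℝ := ∑' n : ℤ, Real.exp (-u * (n : ℝ) ^ 2)

lemma summable_theta {u : ℝ} (hu : 0 < u) :
    Summable (fun n : ℤ => Real.exp (-u * (n : ℝ) ^ 2)) := by
  have h := ((summable_jacobiTheta₂_term_iff 0 (Complex.I * ((u / Real.pi : ℝ) : ℂ))).2
    (by simp; positivity)).norm
  refine h.congr fun n => ?_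
  rw [norm_jacobiTheta₂_term]
  congr 1
  simp
  field_simp

/-- Once exp(-x²/(2t)) is factored out, each image term is the norm of a two-variable Jacobi theta
term with purely imaginary parameters. -/
lemma summable_gaussKernel {t : ℝ} (ht : 0 < t) (x : ℝ) :
    Summable (fun k : ℤ => gaussKernel t (x + 2 * Real.pi * k)) := by
  have h := ((summable_jacobiTheta₂_term_iff (Complex.I * ((x / t : ℝ) : ℂ))
    (Complex.I * ((2 * Real.pi / t : ℝ) : ℂ))).2 (by simp; positivity)).norm
  refine (h.mul_left ((Real.sqrt (2 * Real.pi * t))⁻¹ * Real.exp (-x ^ 2 / (2 * t)))).congr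
    fun n => ?_
  rw [norm_jacobiTheta₂_term, gaussKernel, mul_assoc, ← Real.exp_add]
  congr 2
  simp
  field_simp
  ring

lemma circleHeat_ne_top {t : ℝ} (ht : 0 < t) (x : ℝ) : circleHeat t x ≠ ⊤ := by
  unfold circleHeat
  rw [← ENNReal.ofReal_tsum_of_nonneg (fun _ => gaussKernel_nonneg _ _) (summable_gaussKernel ht x)]
  exact ENNReal.ofReal_ne_top

lemma circleHeat_toReal (t x : ℝ) :
    (circleHeat t x).toReal = ∑' k : ℤ, gaussKernel t (x + 2 * Real.pi * k) := by
  unfold circleHeat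
  rw [ENNReal.tsum_toReal_eq (fun _ => ENNReal.ofReal_ne_top)]
  simp [ENNReal.toReal_ofReal, gaussKernel_nonneg]

/-- Poisson summation for a Gaussian: `Complex.tsum_exp_neg_quadratic` with a = t/(2π) and b =
ix/(2π). Its dual index is the negative of the image index, hence the reindexing by `Equiv.neg`. -/
lemma circleHeat_toReal_fourier {t : ℝ} (ht : 0 < t) (x : ℝ) :
    ((circleHeat t x).toReal : ℂ) = (1 / (2 * Real.pi : ℝ) : ℝ) *
      ∑' n : ℤ, Complex.exp (((-(t / 2) * (n : ℝ) ^ 2 : ℝ) : ℂ) +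
        Complex.I * (((n : ℝ) * x : ℝ) : ℂ)) := by
  have hpi := Real.pi_pos
  have hpi' : (Real.pi : ℂ) ≠ 0 := by exact_mod_cast hpi.ne'
  have ht' : (t : ℂ) ≠ 0 := by exact_mod_cast ht.ne'
  have key := Complex.tsum_exp_neg_quadratic (a := ((t / (2 * Real.pi) : ℝ) : ℂ))
    (by rw [Complex.ofReal_re]; positivity) (Complex.I * ((x / (2 * Real.pi) : ℝ) : ℂ))
  have e1 : ∀ n : ℤ, -(Real.pi : ℂ) * ((t / (2 * Real.pi) : ℝ) : ℂ) * (n : ℂ) ^ 2 +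
      2 * Real.pi * (Complex.I * ((x / (2 * Real.pi) : ℝ) : ℂ)) * n =
      ((-(t / 2) * (n : ℝ) ^ 2 : ℝ) : ℂ) + Complex.I * (((n : ℝ) * x : ℝ) : ℂ) := by
    intro n; push_cast; field_simp
  simp_rw [e1] at key
  rw [key, circleHeat_toReal, Complex.ofReal_tsum, ← (Equiv.neg ℤ).tsum_eq, ← tsum_mul_left,
    ← tsum_mul_left]
  refine tsum_congr fun n => ?_
  have e2 : (1 : ℂ) / ((t / (2 * Real.pi) : ℝ) : ℂ) ^ (1 / 2 : ℂ) =
      ((2 * Real.pi / Real.sqrt (2 * Real.pi * t) : ℝ) : ℂ) := by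
    have h1 : ((t / (2 * Real.pi) : ℝ) : ℂ) ^ (1 / 2 : ℂ) =
        (Real.sqrt (t / (2 * Real.pi)) : ℝ) := by
      rw [Real.sqrt_eq_rpow, Complex.ofReal_cpow (by positivity)]
      push_cast; rfl
    rw [h1, ← Complex.ofReal_one, ← Complex.ofReal_div]
    congr 1
    have h2 : Real.sqrt (2 * Real.pi * t) = 2 * Real.pi * Real.sqrt (t / (2 * Real.pi)) := by
      rw [show 2 * Real.pi * t = (2 * Real.pi) ^ 2 * (t / (2 * Real.pi)) by field_simp,
        Real.sqrt_mul (by positivity), Real.sqrt_sq (by positivity)]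
    rw [h2]
    have : Real.sqrt (t / (2 * Real.pi)) ≠ 0 := by positivity
    field_simp
  have e3 : -(Real.pi : ℂ) / ((t / (2 * Real.pi) : ℝ) : ℂ) *
      ((n : ℂ) + Complex.I * (Complex.I * ((x / (2 * Real.pi) : ℝ) : ℂ))) ^ 2 =
      ((-(x + 2 * Real.pi * (-n : ℤ)) ^ 2 / (2 * t) : ℝ) : ℂ) := by
    rw [← mul_assoc, Complex.I_mul_I]
    push_cast; field_simp; ring
  rw [e2, e3, ← Complex.ofReal_exp, ← Complex.ofReal_mul, ← Complex.ofReal_mul, gaussKernel]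
  congr 1
  simp only [Equiv.neg_apply]
  field_simp

lemma norm_fourierTerm (u : ℝ) (n : ℤ) (x : ℝ) :
    ‖Complex.exp (((-u * (n : ℝ) ^ 2 : ℝ) : ℂ) + Complex.I * (((n : ℝ) * x : ℝ) : ℂ))‖ =
      Real.exp (-u * (n : ℝ) ^ 2) := by
  rw [Complex.norm_exp]; congr 1
  simp only [Complex.add_re, Complex.ofReal_re, Complex.mul_re, Complex.I_re, Complex.I_im,
    Complex.ofReal_im]
  ring

lemma theta_nonneg (u : ℝ) : 0 ≤ theta u := tsum_nonneg fun _ => (Real.exp_pos _).le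

lemma one_le_theta {u : ℝ} (hu : 0 < u) : 1 ≤ theta u := by
  have := (summable_theta hu).le_tsum 0 (fun _ _ => (Real.exp_pos _).le)
  simpa [theta] using this

lemma circleHeat_le {t : ℝ} (ht : 0 < t) (x : ℝ) :
    (circleHeat t x).toReal ≤ 1 / (2 * Real.pi) * theta (t / 2) := by
  have h1 : ((circleHeat t x).toReal : ℝ) = ‖((circleHeat t x).toReal : ℂ)‖ := by simp
  rw [h1, circleHeat_toReal_fourier ht, norm_mul, Complex.norm_real,
    Real.norm_of_nonneg (by positivity)]
  refine mul_le_mul_of_nonneg_left ?_ (by positivity)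
  refine (norm_tsum_le_tsum_norm ?_).trans_eq ?_
  · simp_rw [norm_fourierTerm]; exact summable_theta (by positivity)
  · simp_rw [norm_fourierTerm]; rfl

/-- The constant 1 is the zero mode of the Fourier series, so only the nonzero modes remain, each
bounded by its modulus. -/
lemma abs_circleHeat_sub_le {t : ℝ} (ht : 0 < t) (x : ℝ) :
    |2 * Real.pi * (circleHeat t x).toReal - 1| ≤ theta (t / 2) - 1 := by
  have hs := summable_theta (u := t / 2) (by positivity)
  have hs' : Summable (fun n : ℤ => Complex.exp (((-(t / 2) * (n : ℝ) ^ 2 : ℝ) : ℂ) +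
        Complex.I * (((n : ℝ) * x : ℝ) : ℂ))) := by
    refine Summable.of_norm ?_
    simp_rw [norm_fourierTerm]; exact hs
  have h1 : ((2 * Real.pi * (circleHeat t x).toReal - 1 : ℝ) : ℂ) =
      ∑' n : ℤ, if n = 0 then 0 else Complex.exp (((-(t / 2) * (n : ℝ) ^ 2 : ℝ) : ℂ) +
        Complex.I * (((n : ℝ) * x : ℝ) : ℂ)) := by
    have := hs'.tsum_eq_add_tsum_ite 0
    have hpi' : (Real.pi : ℂ) ≠ 0 := by exact_mod_cast Real.pi_ne_zero
    push_cast at this ⊢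
    rw [circleHeat_toReal_fourier ht]
    push_cast
    rw [this]
    field_simp
    simp
  have h2 : theta (t / 2) - 1 = ∑' n : ℤ, if n = 0 then 0 else
      Real.exp (-(t / 2) * (n : ℝ) ^ 2) := by
    rw [theta, hs.tsum_eq_add_tsum_ite 0]; simp
  rw [← Real.norm_eq_abs, ← Complex.norm_real, h1, h2]
  have hn : ∀ n : ℤ, ‖if n = 0 then 0 else Complex.exp (((-(t / 2) * (n : ℝ) ^ 2 : ℝ) : ℂ) +
        Complex.I * (((n : ℝ) * x : ℝ) : ℂ))‖ =
        if n = 0 then 0 else Real.exp (-(t / 2) * (n : ℝ) ^ 2) := by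
    intro n; split_ifs
    · simp
    · exact norm_fourierTerm _ _ _
  refine (norm_tsum_le_tsum_norm ?_).trans_eq ?_
  · simp_rw [hn]
    refine Summable.of_nonneg_of_le (fun n => ?_) (fun n => ?_) hs
    · split_ifs <;> positivity
    · split_ifs
      · positivity
      · exact le_rfl
  · simp_rw [hn]

lemma theta_anti {u v : ℝ} (hu : 0 < u) (huv : u ≤ v) : theta v ≤ theta u := by
  refine (summable_theta (hu.trans_le huv)).tsum_le_tsum (fun n => ?_) (summable_theta hu)
  apply Real.exp_le_exp.2
  nlinarith [sq_nonneg (n : ℝ)]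

/-- A nonzero integer has n² ≥ 1, so exp(-un²) ≤ exp(1-u) exp(-n²) for each term once the zero mode
is removed. -/
lemma theta_sub_one_le {u : ℝ} (hu : 1 ≤ u) :
    theta u - 1 ≤ Real.exp (1 - u) * (theta 1 - 1) := by
  have h : ∀ u : ℝ, 0 < u → theta u - 1 = ∑' n : ℤ, if n = 0 then 0 else
      Real.exp (-u * (n : ℝ) ^ 2) := by
    intro u hu
    rw [theta, (summable_theta hu).tsum_eq_add_tsum_ite 0]; simp
  have hs : ∀ u : ℝ, 0 < u → Summable (fun n : ℤ => if n = 0 then 0 else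
      Real.exp (-u * (n : ℝ) ^ 2)) := by
    intro u hu
    refine Summable.of_nonneg_of_le (fun n => ?_) (fun n => ?_) (summable_theta hu)
    · split_ifs <;> positivity
    · split_ifs
      · positivity
      · exact le_rfl
  rw [h u (by linarith), h 1 one_pos, ← tsum_mul_left]
  refine (hs u (by linarith)).tsum_le_tsum (fun n => ?_) ((hs 1 one_pos).mul_left _)
  split_ifs with h0
  · simp
  · rw [← Real.exp_add]
    apply Real.exp_le_exp.2
    have : (1 : ℝ) ≤ (n : ℝ) ^ 2 := by
      have : (1 : ℤ) ≤ n ^ 2 := by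
        have := Int.one_le_abs h0
        nlinarith [sq_abs n]
      exact_mod_cast this
    nlinarith

/-- Jacobi inversion u ↦ π²/u; the condition u ≤ π puts the dual argument above π, where the series
is at most `theta Real.pi`. -/
lemma theta_le {u : ℝ} (hu : 0 < u) (hu1 : u ≤ Real.pi) :
    theta u ≤ (Real.pi / u) ^ (1 / 2 : ℝ) * theta Real.pi := by
  have hpi := Real.pi_pos
  have h := Real.tsum_exp_neg_mul_int_sq (a := u / Real.pi) (by positivity)
  have e1 : -Real.pi * (u / Real.pi) = -u := by field_simp
  have e2 : -Real.pi / (u / Real.pi) = -(Real.pi ^ 2 / u) := by field_simp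
  rw [e1, e2] at h
  change theta u = _ * theta (Real.pi ^ 2 / u) at h
  rw [h, one_div (_ ^ _), ← Real.inv_rpow (by positivity), inv_div]
  gcongr
  apply theta_anti hpi
  rw [le_div_iff₀ hu]; nlinarith

/-! ### Bridge factorisation and Fourier coefficients on the circle -/

/-- The Chapman–Kolmogorov factorisation of a product of two Gaussians. -/
lemma gaussKernel_mul {t s : ℝ} (hs : 0 < s) (hst : s < t) (a b : ℝ) :
    gaussKernel (t - s) a * gaussKernel s b =
      gaussKernel t (a + b) * gaussKernel (s * (t - s) / t) (a - (t - s) / t * (a + b)) := by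
  have ht : 0 < t := hs.trans hst
  have hts : 0 < t - s := sub_pos.2 hst
  unfold gaussKernel
  rw [mul_mul_mul_comm, mul_mul_mul_comm (Real.sqrt (2 * Real.pi * t))⁻¹,
    ← Real.exp_add, ← Real.exp_add, ← mul_inv, ← mul_inv,
    ← Real.sqrt_mul (by positivity), ← Real.sqrt_mul (by positivity)]
  congr 2
  · congr 1; field_simp
  · field_simp; ring

/-- The bridge identity summed over images. Grouping pairs of windings by their total m leaves a
free sum that rebuilds a periodised Gaussian; a m is the mean, at the intermediate time, of the
bridge with total winding m. -/
lemma circleHeat_mul {t s : ℝ} (hs : 0 < s) (hst : s < t) (x₀ x : ℝ) :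
    ∃ a : ℤ → ℝ, ∀ z : ℝ, circleHeat (t - s) (z - x) * circleHeat s (x₀ - z) =
      ∑' m : ℤ, ENNReal.ofReal (gaussKernel t (x₀ - x + 2 * Real.pi * m)) *
        circleHeat (s * (t - s) / t) (z - a m) := by
  refine ⟨fun m => x + (t - s) / t * (x₀ - x + 2 * Real.pi * m), fun z => ?_⟩
  unfold circleHeat
  simp_rw [← ENNReal.tsum_mul_left, ← ENNReal.tsum_mul_right]
  rw [ENNReal.tsum_comm]
  conv_rhs => rw [ENNReal.tsum_comm]
  refine tsum_congr fun k => ?_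
  -- The winding of the first factor becomes m - k, where k is that of the second.
  rw [← (Equiv.subRight k).tsum_eq]
  refine tsum_congr fun m => ?_
  rw [← ENNReal.ofReal_mul (gaussKernel_nonneg _ _), ← ENNReal.ofReal_mul (gaussKernel_nonneg _ _),
    gaussKernel_mul hs hst]
  simp only [Equiv.subRight_apply, Int.cast_sub]
  congr 3
  · ring
  · ring

lemma measurable_circleHeat : Measurable (fun p : ℝ × ℝ => circleHeat p.1 p.2) := by
  unfold circleHeat
  refine Measurable.tsum fun k => ENNReal.measurable_ofReal.comp ?_
  exact measurable_gaussKernel.comp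
    (f := fun p : ℝ × ℝ => (p.1, p.2 + 2 * Real.pi * (k : ℝ))) (by fun_prop)

/-- Orthogonality of characters applied to the Fourier series, integrated term by term since the
norms are summable. -/
lemma circleHeat_fourierCoeff {t : ℝ} (ht : 0 < t) (a : ℝ) (k : ℤ) :
    ∫ z in Icc (-Real.pi) Real.pi, ((circleHeat t (z - a)).toReal : ℂ) *
      Complex.exp (-(Complex.I * (((k : ℝ) * z : ℝ) : ℂ))) =
    Complex.exp (((-(t / 2) * (k : ℝ) ^ 2 : ℝ) : ℂ) - Complex.I * (((k : ℝ) * a : ℝ) : ℂ)) := by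
  have hpi := Real.pi_pos
  have hpi' : (Real.pi : ℂ) ≠ 0 := by exact_mod_cast hpi.ne'
  set F : ℤ → ℝ → ℂ := fun n z => (1 / (2 * Real.pi : ℝ) : ℝ) *
    Complex.exp (((-(t / 2) * (n : ℝ) ^ 2 : ℝ) : ℂ) + Complex.I * (((n : ℝ) * (z - a) : ℝ) : ℂ)) *
    Complex.exp (-(Complex.I * (((k : ℝ) * z : ℝ) : ℂ))) with hF
  have hint : ∀ n, ∫ z in Icc (-Real.pi) Real.pi, F n z = if n = k then
      Complex.exp (((-(t / 2) * (k : ℝ) ^ 2 : ℝ) : ℂ) - Complex.I * (((k : ℝ) * a : ℝ) : ℂ))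
      else 0 := by
    intro n
    have hFn : ∀ z : ℝ, F n z = (1 / (2 * Real.pi : ℝ) : ℝ) *
        Complex.exp (((-(t / 2) * (n : ℝ) ^ 2 : ℝ) : ℂ) - Complex.I * (((n : ℝ) * a : ℝ) : ℂ)) *
        Complex.exp (Complex.I * ((n : ℂ) - k) * z) := by
      intro z
      simp only [hF]
      rw [mul_assoc, mul_assoc, ← Complex.exp_add, ← Complex.exp_add]
      congr 2
      push_cast; ring
    simp_rw [hFn]
    rw [integral_Icc_eq_integral_Ioc, ← intervalIntegral.integral_of_le (by linarith),
      intervalIntegral.integral_const_mul]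
    split_ifs with h
    · subst h
      simp
      field_simp
      norm_num
    · have hnk : (n : ℂ) - k ≠ 0 := by
        rw [sub_ne_zero]; exact_mod_cast h
      rw [integral_exp_mul_complex (mul_ne_zero Complex.I_ne_zero hnk)]
      have : Complex.exp (Complex.I * ((n : ℂ) - k) * (Real.pi : ℝ)) =
          Complex.exp (Complex.I * ((n : ℂ) - k) * ((-Real.pi : ℝ) : ℂ)) := by
        rw [Complex.exp_eq_exp_iff_exists_int]
        exact ⟨n - k, by push_cast; ring⟩
      rw [this]; simp
  have hnorm : ∀ n z, ‖F n z‖ = 1 / (2 * Real.pi) * Real.exp (-(t / 2) * (n : ℝ) ^ 2) := by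
    intro n z
    simp only [hF]
    rw [norm_mul, norm_mul, norm_fourierTerm, Complex.norm_real,
      Real.norm_of_nonneg (by positivity), Complex.norm_exp]
    simp
  have hcont : ∀ n, Continuous (F n) := by
    intro n; simp only [hF]; fun_prop
  have hsum := hasSum_integral_of_summable_integral_norm
    (μ := volume.restrict (Icc (-Real.pi) Real.pi)) (F := F)
    (fun n => (hcont n).integrableOn_Icc) (by
      simp_rw [hnorm, integral_const]
      exact ((summable_theta (u := t / 2) (by positivity)).mul_left _).mul_left _)
  have heq : ∀ z : ℝ, ((circleHeat t (z - a)).toReal : ℂ) *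
      Complex.exp (-(Complex.I * (((k : ℝ) * z : ℝ) : ℂ))) = ∑' n, F n z := by
    intro z
    rw [circleHeat_toReal_fourier ht, ← tsum_mul_left, ← tsum_mul_right]
  simp_rw [heq]
  rw [← hsum.tsum_eq]
  simp_rw [hint]
  exact tsum_ite_eq k _

end TorusPAM

namespace TorusPAM

/-! ### The heat kernel on the torus -/

/-- Distributivity over infinite sums; with `ENNReal` values no summability has to be tracked. -/
lemma prod_tsum_eq_tsum_prod {ι : Type*} : ∀ {d : ℕ} (f : Fin d → ι → ENNReal),
    ∏ i, ∑' k, f i k = ∑' k : Fin d → ι, ∏ i, f i (k i)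
  | 0, f => by simp
  | d + 1, f => by
    rw [Fin.prod_univ_succ, prod_tsum_eq_tsum_prod (fun i => f i.succ),
      ← (Fin.consEquiv (fun _ => ι)).tsum_eq, ENNReal.tsum_prod', ← ENNReal.tsum_mul_right]
    refine tsum_congr fun a => ?_
    rw [← ENNReal.tsum_mul_left]
    refine tsum_congr fun k => ?_
    rw [Fin.prod_univ_succ]
    simp [Fin.consEquiv]

/-- The heat kernel on the torus as an extended nonnegative real. -/
noncomputable def eheat {d : ℕ} (t : ℝ) (x : Fin d → ℝ) : ENNReal := ∏ i, circleHeat t (x i)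

variable {d : ℕ}

lemma heat_eq_toReal (t : ℝ) (x : Fin d → ℝ) : heat t x = (eheat t x).toReal := by
  unfold heat eheat circleHeat
  rw [prod_tsum_eq_tsum_prod, ENNReal.tsum_toReal_eq
    (fun _ => ENNReal.prod_ne_top fun _ _ => ENNReal.ofReal_ne_top)]
  simp [ENNReal.toReal_prod, ENNReal.toReal_ofReal, gaussKernel_nonneg]

lemma heat_nonneg (t : ℝ) (x : Fin d → ℝ) : 0 ≤ heat t x := by
  rw [heat_eq_toReal]; positivity

lemma eheat_ne_top {t : ℝ} (ht : 0 < t) (x : Fin d → ℝ) : eheat t x ≠ ⊤ :=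
  ENNReal.prod_ne_top fun _ _ => circleHeat_ne_top ht _

lemma ofReal_heat {t : ℝ} (ht : 0 < t) (x : Fin d → ℝ) :
    ENNReal.ofReal (heat t x) = eheat t x := by
  rw [heat_eq_toReal, ENNReal.ofReal_toReal (eheat_ne_top ht x)]

lemma measurable_eheat : Measurable (fun p : ℝ × (Fin d → ℝ) => eheat p.1 p.2) := by
  unfold eheat
  refine Finset.measurable_fun_prod _ fun i _ => ?_
  exact measurable_circleHeat.comp (f := fun p : ℝ × (Fin d → ℝ) => (p.1, p.2 i)) (by fun_prop)

lemma measurable_heat : Measurable (fun p : ℝ × (Fin d → ℝ) => heat p.1 p.2) := by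
  simp_rw [heat_eq_toReal]
  exact measurable_eheat.ennreal_toReal

lemma circleHeat_add_int (t x : ℝ) (n : ℤ) :
    circleHeat t (x + 2 * Real.pi * n) = circleHeat t x := by
  unfold circleHeat
  rw [← (Equiv.addRight n).tsum_eq (fun k : ℤ => ENNReal.ofReal (gaussKernel t (x + 2 * Real.pi * k)))]
  refine tsum_congr fun k => ?_
  simp only [Equiv.coe_addRight, Int.cast_add]
  congr 2; ring

lemma eheat_wrap (t : ℝ) (x : Fin d → ℝ) : eheat t (wrap x) = eheat t x := by
  unfold eheat wrap
  refine Finset.prod_congr rfl fun i _ => ?_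
  rw [toIcoMod, zsmul_eq_mul, ← circleHeat_add_int t _ (toIcoDiv Real.two_pi_pos (-Real.pi) (x i))]
  congr 1; ring

lemma heat_wrap (t : ℝ) (x : Fin d → ℝ) : heat t (wrap x) = heat t x := by
  rw [heat_eq_toReal, heat_eq_toReal, eheat_wrap]

lemma heat₂_eq (t : ℝ) (x y : Fin d → ℝ) : heat₂ t x y = heat t (x - y) := heat_wrap _ _

lemma heat₂_nonneg (t : ℝ) (x y : Fin d → ℝ) : 0 ≤ heat₂ t x y := heat_nonneg _ _

/-- Tensor product of the circle identities. The weights do not depend on z, which is what lets the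
endpoint kernel leave the integral over z. -/
lemma eheat_mul {t s : ℝ} (hs : 0 < s) (hst : s < t) (x₀ x : Fin d → ℝ) :
    ∃ (w : (Fin d → ℤ) → ENNReal) (a : (Fin d → ℤ) → (Fin d → ℝ)),
      ∑' m, w m = eheat t (x₀ - x) ∧
      ∀ z, eheat (t - s) (z - x) * eheat s (x₀ - z) =
        ∑' m, w m * eheat (s * (t - s) / t) (z - a m) := by
  choose a ha using fun i => circleHeat_mul hs hst (x₀ i) (x i)
  refine ⟨fun m => ∏ i, ENNReal.ofReal (gaussKernel t (x₀ i - x i + 2 * Real.pi * m i)),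
    fun m i => a i (m i), ?_, fun z => ?_⟩
  · unfold eheat circleHeat
    rw [prod_tsum_eq_tsum_prod]; rfl
  · unfold eheat
    simp_rw [← Finset.prod_mul_distrib, Pi.sub_apply, ha]
    rw [prod_tsum_eq_tsum_prod]

lemma torus_eq_pi : torus d = Set.univ.pi fun _ => Icc (-Real.pi) Real.pi :=
  (Set.pi_univ_Icc _ _).symm

lemma volume_torus_ne_top : volume (torus d) ≠ ⊤ := by
  unfold torus
  exact (isCompact_Icc.measure_lt_top).ne

lemma restrict_torus : (volume : Measure (Fin d → ℝ)).restrict (torus d) =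
    Measure.pi fun _ => (volume : Measure ℝ).restrict (Icc (-Real.pi) Real.pi) := by
  rw [torus_eq_pi, volume_pi, Measure.restrict_pi_pi]

lemma heat_fourierCoeff {t : ℝ} (ht : 0 < t) (a : Fin d → ℝ) (k : Fin d → ℤ) :
    ∫ z in torus d, ((heat t (z - a) : ℝ) : ℂ) *
      Complex.exp (-(Complex.I * ((∑ i, (k i : ℝ) * z i : ℝ) : ℂ))) =
    Complex.exp (((-(t / 2) * ∑ i, (k i : ℝ) ^ 2 : ℝ) : ℂ) -
      Complex.I * ((∑ i, (k i : ℝ) * a i : ℝ) : ℂ)) := by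
  have h : ∀ z : Fin d → ℝ, ((heat t (z - a) : ℝ) : ℂ) *
      Complex.exp (-(Complex.I * ((∑ i, (k i : ℝ) * z i : ℝ) : ℂ))) =
      ∏ i, (((circleHeat t (z i - a i)).toReal : ℂ) *
      Complex.exp (-(Complex.I * (((k i : ℝ) * z i : ℝ) : ℂ)))) := by
    intro z
    rw [heat_eq_toReal, eheat, ENNReal.toReal_prod, Complex.ofReal_prod, Finset.prod_mul_distrib,
      ← Complex.exp_sum, Complex.ofReal_sum, Finset.mul_sum, Finset.sum_neg_distrib]
    rfl
  simp_rw [h]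
  rw [restrict_torus, integral_fintype_prod_eq_prod (𝕜 := ℂ) (fun i (y : ℝ) =>
    ((circleHeat t (y - a i)).toReal : ℂ) * Complex.exp (-(Complex.I * (((k i : ℝ) * y : ℝ) : ℂ))))]
  simp_rw [circleHeat_fourierCoeff ht]
  rw [← Complex.exp_sum, Finset.sum_sub_distrib, Finset.mul_sum, Complex.ofReal_sum,
    Complex.ofReal_sum, Finset.mul_sum]

/-! ### Uniform bounds, total mass and the semigroup law -/

lemma heat_le {t : ℝ} (ht : 0 < t) (x : Fin d → ℝ) :
    heat t x ≤ (1 / (2 * Real.pi)) ^ d * theta (t / 2) ^ d := by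
  rw [heat_eq_toReal, eheat, ENNReal.toReal_prod, ← mul_pow]
  refine (Finset.prod_le_prod (fun _ _ => ENNReal.toReal_nonneg)
    (fun i _ => circleHeat_le ht (x i))).trans_eq ?_
  simp

lemma abs_prod_one_add_sub_one_le {ι : Type*} (s : Finset ι) (f : ι → ℝ) {E : ℝ} (hE : 0 ≤ E)
    (hf : ∀ i, |f i - 1| ≤ E) : |∏ i ∈ s, f i - 1| ≤ (1 + E) ^ s.card - 1 := by
  classical
  induction s using Finset.induction_on with
  | empty => simp
  | insert i s hi ih =>
    rw [Finset.prod_insert hi, Finset.card_insert_of_notMem hi, pow_succ]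
    have h1 : f i * ∏ j ∈ s, f j - 1 = f i * (∏ j ∈ s, f j - 1) + (f i - 1) := by ring
    have h2 : |f i| ≤ 1 + E := by
      have := hf i
      rw [abs_le] at *; constructor <;> linarith
    rw [h1]
    refine (abs_add_le _ _).trans ?_
    rw [abs_mul]
    have := mul_le_mul h2 ih (abs_nonneg _) (by linarith)
    linarith [hf i]

lemma abs_heat_sub_le {t : ℝ} (ht : 0 < t) (x : Fin d → ℝ) :
    |heat t x - 1 / (2 * Real.pi) ^ d| ≤ (1 / (2 * Real.pi)) ^ d * (theta (t / 2) ^ d - 1) := by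
  have hpi := Real.pi_pos
  have h := abs_prod_one_add_sub_one_le Finset.univ
    (fun i => 2 * Real.pi * (circleHeat t (x i)).toReal) (E := theta (t / 2) - 1)
    (by linarith [one_le_theta (u := t / 2) (by positivity)])
    (fun i => abs_circleHeat_sub_le ht (x i))
  have h1 : heat t x - 1 / (2 * Real.pi) ^ d = (1 / (2 * Real.pi)) ^ d *
      (∏ i, (2 * Real.pi * (circleHeat t (x i)).toReal) - 1) := by
    rw [heat_eq_toReal, eheat, ENNReal.toReal_prod, Finset.prod_mul_distrib]
    simp only [Finset.prod_const, Finset.card_univ, Fintype.card_fin, one_div_pow]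
    field_simp
  rw [h1, abs_mul, abs_of_nonneg (by positivity)]
  refine mul_le_mul_of_nonneg_left (h.trans_eq ?_) (by positivity)
  simp

lemma exp_neg_le_rpow (d : ℕ) {u : ℝ} (hu : 1 ≤ u) :
    Real.exp (-u) ≤ d.factorial * u ^ (-(d : ℝ) / 2) := by
  have hu0 : 0 < u := by linarith
  have h1 := Real.pow_div_factorial_le_exp u hu0.le d
  have h2 : u ^ ((d : ℝ) / 2) ≤ u ^ d := by
    rw [← Real.rpow_natCast]
    exact Real.rpow_le_rpow_of_exponent_le hu (by have := d.cast_nonneg (α := ℝ); linarith)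
  rw [neg_div, Real.rpow_neg hu0.le, Real.exp_neg, ← div_eq_mul_inv]
  rw [inv_le_comm₀ (Real.exp_pos _) (by positivity), inv_div]
  refine le_trans ?_ h1
  gcongr

/-- The diagonal of the heat kernel minus its mean decays like `u^{-d/2}` on the whole half-line. -/
lemma exists_theta_pow_sub_one_le (hd : 0 < d) : ∃ C : ℝ, 0 < C ∧
    ∀ u : ℝ, 0 < u → theta u ^ d - 1 ≤ C * u ^ (-(d : ℝ) / 2) := by
  have hpi := Real.pi_pos
  -- Geometric sum: B^d - 1 is B - 1 times d powers of B, each at most A^d. This makes the decay of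
  -- `theta u - 1` pass to the d-th power.
  have hp : ∀ A : ℝ, 1 ≤ A → ∀ B : ℝ, 1 ≤ B → B ≤ A → B ^ d - 1 ≤ d * A ^ d * (B - 1) := by
    intro A hA B hB hBA
    have h1 : B ^ d - 1 = (∑ i ∈ Finset.range d, B ^ i) * (B - 1) := (geom_sum_mul B d).symm
    rw [h1]
    refine mul_le_mul_of_nonneg_right ?_ (by linarith)
    refine (Finset.sum_le_card_nsmul _ _ (A ^ d) fun i hi => ?_).trans_eq (by simp)
    have := Finset.mem_range.1 hi
    exact (pow_le_pow_left₀ (by linarith) hBA i).trans (pow_le_pow_right₀ hA this.le)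
  have hth := one_le_theta one_pos
  have hthpi := one_le_theta hpi
  -- The first summand serves u ≥ 1 (exponential decay), the second u ≤ 1 (inversion).
  refine ⟨d * theta 1 ^ d * (Real.exp 1 * theta 1) * d.factorial +
    Real.pi ^ ((d : ℝ) / 2) * theta Real.pi ^ d, by positivity, fun u hu => ?_⟩
  rw [add_mul]
  rcases le_total u 1 with h | h
  · have h1 := theta_le hu (h.trans (by linarith [Real.pi_gt_three]))
    have h2 : theta u ^ d ≤ Real.pi ^ ((d : ℝ) / 2) * theta Real.pi ^ d * u ^ (-(d : ℝ) / 2) := by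
      refine (pow_le_pow_left₀ (theta_nonneg _) h1 d).trans_eq ?_
      rw [mul_pow, ← Real.rpow_natCast (_ ^ (1 / 2 : ℝ)), ← Real.rpow_mul (by positivity),
        Real.div_rpow hpi.le hu.le, neg_div, Real.rpow_neg hu.le,
        show (1 / 2 : ℝ) * d = d / 2 by ring]
      ring
    have : 0 ≤ d * theta 1 ^ d * (Real.exp 1 * theta 1) * d.factorial * u ^ (-(d : ℝ) / 2) := by
      positivity
    linarith
  · have h1 := hp (theta 1) hth (theta u) (one_le_theta hu) (theta_anti one_pos h)
    have h2 := theta_sub_one_le h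
    have h3 := exp_neg_le_rpow d h
    have h4 : theta u - 1 ≤ Real.exp 1 * theta 1 * (d.factorial * u ^ (-(d : ℝ) / 2)) := by
      refine h2.trans ?_
      rw [sub_eq_add_neg, Real.exp_add]
      calc Real.exp 1 * Real.exp (-u) * (theta 1 - 1)
          ≤ Real.exp 1 * Real.exp (-u) * theta 1 := by gcongr; linarith
        _ = Real.exp 1 * theta 1 * Real.exp (-u) := by ring
        _ ≤ _ := by gcongr
    have h5 : 0 ≤ Real.pi ^ ((d : ℝ) / 2) * theta Real.pi ^ d * u ^ (-(d : ℝ) / 2) := by positivity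
    have h6 := mul_le_mul_of_nonneg_left h4 (show 0 ≤ d * theta 1 ^ d by positivity)
    linarith

lemma integrable_heat {t : ℝ} (ht : 0 < t) (a : Fin d → ℝ) :
    IntegrableOn (fun z => heat t (z - a)) (torus d) := by
  refine Measure.integrableOn_of_bounded volume_torus_ne_top ?_
    (M := (1 / (2 * Real.pi)) ^ d * theta (t / 2) ^ d) ?_
  · exact (measurable_heat.comp (f := fun z : Fin d → ℝ => (t, z - a))
      (by fun_prop)).aestronglyMeasurable
  · refine ae_of_all _ fun z => ?_
    rw [Real.norm_of_nonneg (heat_nonneg _ _)]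
    exact heat_le ht _

/-- The total mass is the Fourier coefficient at k = 0. -/
lemma lintegral_eheat {t : ℝ} (ht : 0 < t) (a : Fin d → ℝ) :
    ∫⁻ z in torus d, eheat t (z - a) = 1 := by
  have h := heat_fourierCoeff ht a 0
  simp only [Pi.zero_apply, Int.cast_zero, zero_mul, Finset.sum_const_zero, Complex.ofReal_zero,
    mul_zero, neg_zero, Complex.exp_zero, mul_one, ne_eq, OfNat.ofNat_ne_zero, not_false_eq_true,
    zero_pow, sub_zero] at h
  rw [integral_complex_ofReal] at h
  have h' : ∫ z in torus d, heat t (z - a) = 1 := by exact_mod_cast h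
  simp_rw [← ofReal_heat ht]
  rw [← ofReal_integral_eq_lintegral_ofReal (integrable_heat ht a)
    (ae_of_all _ fun _ => heat_nonneg _ _), h', ENNReal.ofReal_one]

/-- The semigroup law read off from the bridge mixture: each component has mass one, so the integral
is the total weight. -/
lemma lintegral_eheat_mul {s u : ℝ} (hs : 0 < s) (hu : 0 < u) (a y : Fin d → ℝ) :
    ∫⁻ z in torus d, eheat s (z - a) * eheat u (y - z) = eheat (s + u) (y - a) := by
  obtain ⟨w, b, hw, h⟩ := eheat_mul (d := d) hu (show u < s + u by linarith) y a
  rw [add_sub_cancel_right] at h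
  simp_rw [h]
  rw [lintegral_tsum]
  · have : ∀ m, ∫⁻ z in torus d, w m * eheat (u * s / (s + u)) (z - b m) = w m := by
      intro m
      rw [lintegral_const_mul, lintegral_eheat (by positivity), mul_one]
      exact measurable_eheat.comp (f := fun z : Fin d → ℝ => (_, z - b m)) (by fun_prop)
    simp_rw [this, hw]
  · intro m
    exact ((measurable_eheat.comp (f := fun z : Fin d → ℝ => (_, z - b m))
      (by fun_prop)).const_mul _).aemeasurable

end TorusPAM

namespace TorusPAM

/-! ### The covariance function -/

variable {d : ℕ}

lemma lintegral_Ioc_rpow {α σ : ℝ} (hα : 0 < α) (hσ : 0 < σ) :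
    ∫⁻ t in Ioc 0 σ, ENNReal.ofReal (t ^ (α - 1)) = ENNReal.ofReal (σ ^ α / α) := by
  have hi : IntervalIntegrable (fun t : ℝ => t ^ (α - 1)) volume 0 σ :=
    intervalIntegral.intervalIntegrable_rpow' (by linarith)
  rw [← ofReal_integral_eq_lintegral_ofReal
    ((intervalIntegrable_iff_integrableOn_Ioc_of_le hσ.le).1 hi)
    ((ae_restrict_iff' measurableSet_Ioc).2 (ae_of_all _ fun t ht => Real.rpow_nonneg ht.1.le _)),
    ← intervalIntegral.integral_of_le hσ.le, integral_rpow (Or.inl (by linarith))]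
  simp [Real.zero_rpow hα.ne']

lemma lintegral_Ioi_rpow {a σ : ℝ} (ha : a < -1) (hσ : 0 < σ) :
    ∫⁻ t in Ioi σ, ENNReal.ofReal (t ^ a) = ENNReal.ofReal (-σ ^ (a + 1) / (a + 1)) := by
  rw [← ofReal_integral_eq_lintegral_ofReal (integrableOn_Ioi_rpow_of_lt ha hσ)
    ((ae_restrict_iff' measurableSet_Ioi).2
      (ae_of_all _ fun t ht => Real.rpow_nonneg (hσ.trans ht).le _)),
    integral_Ioi_rpow_of_lt ha hσ]

/-- Split at t = σ: below it (σ+t)^(-D) ≤ σ^(-D), above it (σ+t)^(-D) ≤ t^(-D). Both pieces scale as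
σ^(α-D). -/
lemma exists_lintegral_rpow_mul_add_rpow_le {α D : ℝ} (hα : 0 < α) (hD : α < D) :
    ∃ B : ℝ, 0 < B ∧ ∀ σ : ℝ, 0 < σ →
      ∫⁻ t in Ioi 0, ENNReal.ofReal (t ^ (α - 1) * (σ + t) ^ (-D)) ≤
        ENNReal.ofReal (B * σ ^ (α - D)) := by
  have hDα : 0 < D - α := by linarith
  refine ⟨1 / α + 1 / (D - α), by positivity, fun σ hσ => ?_⟩
  rw [← Ioc_union_Ioi_eq_Ioi hσ.le, lintegral_union measurableSet_Ioi
    (Set.disjoint_left.2 fun x hx hx' => not_lt.2 hx.2 hx'), add_mul,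
    ENNReal.ofReal_add (by positivity) (by positivity)]
  refine add_le_add ?_ ?_
  · calc ∫⁻ t in Ioc 0 σ, ENNReal.ofReal (t ^ (α - 1) * (σ + t) ^ (-D))
        ≤ ∫⁻ t in Ioc 0 σ, ENNReal.ofReal (t ^ (α - 1)) * ENNReal.ofReal (σ ^ (-D)) := by
          refine setLIntegral_mono' measurableSet_Ioc fun t ht => ?_
          rw [← ENNReal.ofReal_mul (Real.rpow_nonneg ht.1.le _)]
          refine ENNReal.ofReal_le_ofReal (mul_le_mul_of_nonneg_left ?_ (Real.rpow_nonneg ht.1.le _))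
          exact Real.rpow_le_rpow_of_nonpos hσ (by linarith [ht.1]) (by linarith)
      _ = _ := by
          rw [lintegral_mul_const _ (by fun_prop), lintegral_Ioc_rpow hα hσ,
            ← ENNReal.ofReal_mul (by positivity), sub_eq_add_neg, Real.rpow_add hσ]
          congr 1; ring
  · calc ∫⁻ t in Ioi σ, ENNReal.ofReal (t ^ (α - 1) * (σ + t) ^ (-D))
        ≤ ∫⁻ t in Ioi σ, ENNReal.ofReal (t ^ (α - 1 - D)) := by
          refine setLIntegral_mono' measurableSet_Ioi fun t ht => ?_
          have ht0 : 0 < t := hσ.trans ht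
          rw [sub_eq_add_neg (α - 1), Real.rpow_add ht0]
          refine ENNReal.ofReal_le_ofReal (mul_le_mul_of_nonneg_left ?_ (Real.rpow_nonneg ht0.le _))
          exact Real.rpow_le_rpow_of_nonpos ht0 (by linarith) (by linarith)
      _ = _ := by
          rw [lintegral_Ioi_rpow (by linarith) hσ]
          congr 1
          rw [show α - 1 - D + 1 = -(D - α) by ring, neg_div_neg_eq, neg_sub]
          ring
      _ ≤ _ := le_rfl

lemma exists_heat_sub_le (hd : 0 < d) : ∃ C : ℝ, 0 < C ∧ ∀ t : ℝ, 0 < t → ∀ x : Fin d → ℝ,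
    |heat t x - 1 / (2 * Real.pi) ^ d| ≤ C * t ^ (-(d : ℝ) / 2) := by
  obtain ⟨C, hC, h⟩ := exists_theta_pow_sub_one_le hd
  have hpi := Real.pi_pos
  refine ⟨(1 / (2 * Real.pi)) ^ d * (C * 2 ^ ((d : ℝ) / 2)), by positivity, fun t ht x => ?_⟩
  refine (abs_heat_sub_le ht x).trans ?_
  rw [mul_assoc]
  refine mul_le_mul_of_nonneg_left ((h (t / 2) (by positivity)).trans_eq ?_) (by positivity)
  rw [Real.div_rpow ht.le (by norm_num), neg_div, Real.rpow_neg (by norm_num : (0 : ℝ) ≤ 2),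
    div_inv_eq_mul]
  ring

/-- Beyond time 1 the decay t^(-d/2) suffices because α < d/2. Before time 1 the integral may be
infinite on the diagonal, so the heat kernel is kept for later averaging in space. -/
lemma exists_lintegral_enorm_le {α : ℝ} (hα : 0 < α) (hαd : α < (d : ℝ) / 2) :
    ∃ A : ℝ, 0 < A ∧ ∀ x : Fin d → ℝ,
      ∫⁻ t in Ioi (0 : ℝ), ‖t ^ (α - 1) * (heat t x - 1 / (2 * Real.pi) ^ d)‖ₑ ≤
        ENNReal.ofReal A + ∫⁻ t in Ioc 0 1, ENNReal.ofReal (t ^ (α - 1)) * eheat t x := by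
  have hpi := Real.pi_pos
  have hd : 0 < d := by
    rcases Nat.eq_zero_or_pos d with h | h
    · subst h; norm_num at hαd; linarith
    · exact h
  obtain ⟨C, hC, hb⟩ := exists_heat_sub_le hd
  have hD : 0 < (d : ℝ) / 2 - α := by linarith
  refine ⟨1 / α * (1 / (2 * Real.pi) ^ d) + C * (1 / ((d : ℝ) / 2 - α)), by positivity,
    fun x => ?_⟩
  rw [← Ioc_union_Ioi_eq_Ioi (zero_le_one' ℝ), lintegral_union measurableSet_Ioi
    (Set.disjoint_left.2 fun x hx hx' => not_lt.2 hx.2 hx'),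
    ENNReal.ofReal_add (by positivity) (by positivity), add_assoc, add_comm (ENNReal.ofReal _),
    add_assoc]
  rw [add_comm]
  refine add_le_add ?_ ?_
  · calc ∫⁻ t in Ioi (1 : ℝ), ‖t ^ (α - 1) * (heat t x - 1 / (2 * Real.pi) ^ d)‖ₑ
        ≤ ∫⁻ t in Ioi (1 : ℝ), ENNReal.ofReal C * ENNReal.ofReal (t ^ (α - 1 - (d : ℝ) / 2)) := by
          refine setLIntegral_mono' measurableSet_Ioi fun t ht => ?_
          have ht0 : 0 < t := one_pos.trans ht
          rw [← ENNReal.ofReal_mul hC.le, Real.enorm_eq_ofReal_abs, abs_mul,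
            abs_of_nonneg (Real.rpow_nonneg ht0.le _), sub_eq_add_neg (α - 1), Real.rpow_add ht0,
            ← neg_div]
          refine ENNReal.ofReal_le_ofReal ?_
          rw [mul_left_comm]
          exact mul_le_mul_of_nonneg_left (hb t ht0 x) (Real.rpow_nonneg ht0.le _)
      _ = _ := by
          rw [lintegral_const_mul _ (by fun_prop), lintegral_Ioi_rpow (by linarith) one_pos,
            ← ENNReal.ofReal_mul hC.le]
          congr 2
          rw [show α - 1 - (d : ℝ) / 2 + 1 = -((d : ℝ) / 2 - α) by ring, neg_div_neg_eq,
            Real.one_rpow]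
  · calc ∫⁻ t in Ioc (0 : ℝ) 1, ‖t ^ (α - 1) * (heat t x - 1 / (2 * Real.pi) ^ d)‖ₑ
        ≤ ∫⁻ t in Ioc (0 : ℝ) 1, (ENNReal.ofReal (t ^ (α - 1)) * eheat t x +
            ENNReal.ofReal (t ^ (α - 1)) * ENNReal.ofReal (1 / (2 * Real.pi) ^ d)) := by
          refine setLIntegral_mono' measurableSet_Ioc fun t ht => ?_
          rw [enorm_mul, Real.enorm_eq_ofReal (Real.rpow_nonneg ht.1.le _), ← mul_add]
          refine mul_le_mul_right ?_ _
          refine (enorm_sub_le).trans ?_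
          rw [Real.enorm_eq_ofReal (heat_nonneg _ _), Real.enorm_eq_ofReal (by positivity),
            ofReal_heat ht.1]
      _ = _ := by
          rw [lintegral_add_right _ (by fun_prop), lintegral_mul_const _ (by fun_prop),
            lintegral_Ioc_rpow hα one_pos, ← ENNReal.ofReal_mul (by positivity), Real.one_rpow]

lemma exists_enorm_cov_le {α ρ : ℝ} (hρ : 0 ≤ ρ) (hα : 0 < α) (hαd : α < (d : ℝ) / 2) :
    ∃ A : ℝ, 0 < A ∧ ∀ x : Fin d → ℝ, ‖cov α ρ x‖ₑ ≤
      ENNReal.ofReal A + ENNReal.ofReal (1 / Real.Gamma α) *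
        ∫⁻ t in Ioc 0 1, ENNReal.ofReal (t ^ (α - 1)) * eheat t x := by
  have hpi := Real.pi_pos
  obtain ⟨A, hA, h⟩ := exists_lintegral_enorm_le hα hαd
  have hΓ := Real.Gamma_pos_of_pos hα
  refine ⟨ρ / (2 * Real.pi) ^ d + 1 / Real.Gamma α * A, by positivity, fun x => ?_⟩
  unfold cov
  refine (enorm_add_le _ _).trans ?_
  rw [ENNReal.ofReal_add (by positivity) (by positivity), add_assoc,
    Real.enorm_eq_ofReal (by positivity), enorm_mul, Real.enorm_eq_ofReal (by positivity),
    ENNReal.ofReal_mul (by positivity), ← mul_add]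
  gcongr
  exact (enorm_integral_le_lintegral_enorm _).trans (h x)

lemma measurable_cov (α ρ : ℝ) : Measurable (cov α ρ : (Fin d → ℝ) → ℝ) := by
  unfold cov
  refine Measurable.const_add (Measurable.const_mul ?_ _) _
  have hm : Measurable (fun p : (Fin d → ℝ) × ℝ =>
      p.2 ^ (α - 1) * (heat p.2 p.1 - 1 / (2 * Real.pi) ^ d)) := by
    have := measurable_heat.comp (f := fun p : (Fin d → ℝ) × ℝ => (p.2, p.1)) (by fun_prop)
    exact (by fun_prop : Measurable fun p : (Fin d → ℝ) × ℝ => p.2 ^ (α - 1)).mul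
      (this.sub_const _)
  exact (hm.stronglyMeasurable.integral_prod_right (ν := volume.restrict (Ioi (0 : ℝ)))).measurable

lemma measurable_wrap : Measurable (wrap : (Fin d → ℝ) → (Fin d → ℝ)) := by
  refine measurable_pi_lambda _ fun i => ?_
  unfold wrap
  simp_rw [toIcoMod_eq_add_fract_mul]
  fun_prop

lemma measurable_cov₂ (α ρ : ℝ) :
    Measurable (fun p : (Fin d → ℝ) × (Fin d → ℝ) => cov₂ α ρ p.1 p.2) := by
  unfold cov₂
  exact (measurable_cov α ρ).comp (measurable_wrap.comp (by fun_prop))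

/-- Tonelli and the semigroup law turn the average of G(t) under G(σ) into G(σ+t), whose excess over
the mean is at most C(σ+t)^(-d/2). The time integral then produces σ^(α-d/2). -/
lemma exists_lintegral_eheat_mul_cov₂_le {α ρ : ℝ} (hρ : 0 ≤ ρ) (hα : 0 < α)
    (hαd : α < (d : ℝ) / 2) :
    ∃ C : ℝ, 0 < C ∧ ∀ σ : ℝ, 0 < σ → ∀ z a : Fin d → ℝ,
      ∫⁻ z' in torus d, eheat σ (z' - a) * ‖cov₂ α ρ z z'‖ₑ ≤
        ENNReal.ofReal (C * (1 + σ ^ (α - (d : ℝ) / 2))) := by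
  have hpi := Real.pi_pos
  have hd : 0 < d := by
    rcases Nat.eq_zero_or_pos d with h | h
    · subst h; norm_num at hαd; linarith
    · exact h
  have hΓ := Real.Gamma_pos_of_pos hα
  obtain ⟨A, hA, hcov⟩ := exists_enorm_cov_le (d := d) hρ hα hαd
  obtain ⟨C, hC, hb⟩ := exists_heat_sub_le hd
  obtain ⟨B, hB, hint⟩ := exists_lintegral_rpow_mul_add_rpow_le hα hαd
  set c := 1 / (2 * Real.pi) ^ d with hc
  have hc0 : 0 < c := by positivity
  set g := 1 / Real.Gamma α with hg
  have hg0 : 0 < g := by positivity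
  refine ⟨(A + g * (1 / α * c)) + g * (C * B), by positivity, fun σ hσ z a => ?_⟩
  have hme : Measurable fun z' : Fin d → ℝ => eheat σ (z' - a) :=
    measurable_eheat.comp (f := fun z' : Fin d → ℝ => (σ, z' - a)) (by fun_prop)
  have hm2 : Measurable fun p : (Fin d → ℝ) × ℝ =>
      eheat σ (p.1 - a) * (ENNReal.ofReal (p.2 ^ (α - 1)) * eheat p.2 (z - p.1)) :=
    (hme.comp measurable_fst).mul ((by fun_prop : Measurable fun p : (Fin d → ℝ) × ℝ =>
      ENNReal.ofReal (p.2 ^ (α - 1))).mul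
      (measurable_eheat.comp (f := fun p : (Fin d → ℝ) × ℝ => (p.2, z - p.1)) (by fun_prop)))
  have hm3 : Measurable fun z' : Fin d → ℝ =>
      ∫⁻ t in Ioc (0 : ℝ) 1, eheat σ (z' - a) * (ENNReal.ofReal (t ^ (α - 1)) * eheat t (z - z')) :=
    hm2.lintegral_prod_right'
  calc ∫⁻ z' in torus d, eheat σ (z' - a) * ‖cov₂ α ρ z z'‖ₑ
      ≤ ∫⁻ z' in torus d, (ENNReal.ofReal A * eheat σ (z' - a) + ENNReal.ofReal g *
          ∫⁻ t in Ioc (0 : ℝ) 1,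
            eheat σ (z' - a) * (ENNReal.ofReal (t ^ (α - 1)) * eheat t (z - z'))) := by
        refine lintegral_mono fun z' => ?_
        refine (mul_le_mul_right (hcov (wrap (z - z'))) _).trans_eq ?_
        simp_rw [eheat_wrap]
        rw [lintegral_const_mul', mul_add, mul_comm (eheat _ _), mul_left_comm]
        exact eheat_ne_top hσ _
    _ = ENNReal.ofReal A + ENNReal.ofReal g * ∫⁻ t in Ioc (0 : ℝ) 1,
          ENNReal.ofReal (t ^ (α - 1)) * eheat (σ + t) (z - a) := by
        rw [lintegral_add_right _ (hm3.const_mul _), lintegral_const_mul _ hme,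
          lintegral_eheat hσ, mul_one, lintegral_const_mul _ hm3,
          lintegral_lintegral_swap hm2.aemeasurable]
        congr 2
        refine setLIntegral_congr_fun measurableSet_Ioc fun t ht => ?_
        simp_rw [mul_left_comm (eheat σ _)]
        rw [lintegral_const_mul' _ _ ENNReal.ofReal_ne_top, lintegral_eheat_mul hσ ht.1]
    _ ≤ ENNReal.ofReal A + ENNReal.ofReal g * ∫⁻ t in Ioc (0 : ℝ) 1,
          (ENNReal.ofReal (t ^ (α - 1)) * ENNReal.ofReal c + ENNReal.ofReal C *
            ENNReal.ofReal (t ^ (α - 1) * (σ + t) ^ (-((d : ℝ) / 2)))) := by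
        refine add_le_add le_rfl (mul_le_mul_right ?_ _)
        refine setLIntegral_mono' measurableSet_Ioc fun t ht => ?_
        rw [← ofReal_heat (by linarith [ht.1]), ← ENNReal.ofReal_mul (Real.rpow_nonneg ht.1.le _),
          ← ENNReal.ofReal_mul (Real.rpow_nonneg ht.1.le _), ← ENNReal.ofReal_mul hC.le,
          ← ENNReal.ofReal_add (mul_nonneg (Real.rpow_nonneg ht.1.le _) hc0.le)
            (mul_nonneg hC.le (mul_nonneg (Real.rpow_nonneg ht.1.le _)
              (Real.rpow_nonneg (by linarith [ht.1]) _))), mul_left_comm C, ← mul_add]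
        refine ENNReal.ofReal_le_ofReal (mul_le_mul_of_nonneg_left ?_ (Real.rpow_nonneg ht.1.le _))
        have := (abs_le.1 (hb (σ + t) (by linarith [ht.1]) (z - a))).2
        rw [neg_div] at this
        linarith
    _ ≤ ENNReal.ofReal A + ENNReal.ofReal g * (ENNReal.ofReal (1 / α) * ENNReal.ofReal c +
          ENNReal.ofReal C * ENNReal.ofReal (B * σ ^ (α - (d : ℝ) / 2))) := by
        refine add_le_add le_rfl (mul_le_mul_right ?_ _)
        rw [lintegral_add_left (by fun_prop), lintegral_mul_const _ (by fun_prop),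
          lintegral_Ioc_rpow hα one_pos, Real.one_rpow, lintegral_const_mul _ (by fun_prop)]
        gcongr
        exact (lintegral_mono_set Ioc_subset_Ioi_self).trans (hint σ hσ)
    _ ≤ _ := by
        have hs : 0 ≤ σ ^ (α - (d : ℝ) / 2) := Real.rpow_nonneg hσ.le _
        rw [← ENNReal.ofReal_mul (by positivity), ← ENNReal.ofReal_mul hC.le,
          ← ENNReal.ofReal_add (by positivity) (by positivity), ← ENNReal.ofReal_mul hg0.le,
          ← ENNReal.ofReal_add hA.le (by positivity)]
        refine ENNReal.ofReal_le_ofReal ?_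
        have : 0 ≤ (A + g * (1 / α * c)) * σ ^ (α - (d : ℝ) / 2) := by positivity
        have : 0 ≤ g * (C * B) := by positivity
        nlinarith

end TorusPAM

namespace TorusPAM

/-! ### The Fourier coefficients of the covariance and the kernels `k₁`, `k₂` -/

variable {d : ℕ}

lemma integral_torus_exp (k : Fin d → ℤ) :
    ∫ x in torus d, Complex.exp (-(Complex.I * ((∑ i, (k i : ℝ) * x i : ℝ) : ℂ))) =
      if k = 0 then (((2 * Real.pi) ^ d : ℝ) : ℂ) else 0 := by
  have hpi := Real.pi_pos
  have h1 : ∀ m : ℤ, ∫ x in Icc (-Real.pi) Real.pi,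
      Complex.exp (-(Complex.I * (((m : ℝ) * x : ℝ) : ℂ))) =
        if m = 0 then ((2 * Real.pi : ℝ) : ℂ) else 0 := by
    intro m
    rw [integral_Icc_eq_integral_Ioc, ← intervalIntegral.integral_of_le (by linarith)]
    split_ifs with h
    · subst h
      simp; ring
    · have hm : (m : ℂ) ≠ 0 := by exact_mod_cast h
      have e : ∀ x : ℝ, -(Complex.I * (((m : ℝ) * x : ℝ) : ℂ)) = (-Complex.I * m) * x := by
        intro x; push_cast; ring
      simp_rw [e]
      rw [integral_exp_mul_complex (mul_ne_zero (neg_ne_zero.2 Complex.I_ne_zero) hm)]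
      have : Complex.exp (-Complex.I * m * (Real.pi : ℝ)) =
          Complex.exp (-Complex.I * m * ((-Real.pi : ℝ) : ℂ)) := by
        rw [Complex.exp_eq_exp_iff_exists_int]
        exact ⟨-m, by push_cast; ring⟩
      rw [this]; simp
  have h2 : ∀ x : Fin d → ℝ, Complex.exp (-(Complex.I * ((∑ i, (k i : ℝ) * x i : ℝ) : ℂ))) =
      ∏ i, Complex.exp (-(Complex.I * (((k i : ℝ) * x i : ℝ) : ℂ))) := by
    intro x
    rw [← Complex.exp_sum, Complex.ofReal_sum, Finset.mul_sum, Finset.sum_neg_distrib]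
  simp_rw [h2]
  rw [restrict_torus, integral_fintype_prod_eq_prod (𝕜 := ℂ) (fun i (y : ℝ) =>
    Complex.exp (-(Complex.I * (((k i : ℝ) * y : ℝ) : ℂ))))]
  simp_rw [h1]
  split_ifs with h
  · subst h; simp
  · obtain ⟨i, hi⟩ := Function.ne_iff.1 h
    exact Finset.prod_eq_zero (Finset.mem_univ i) (if_neg hi)

/-- The Fourier coefficients of the covariance, up to the factor `(2π)^{-d/2}`. -/
noncomputable def covCoeff (α ρ : ℝ) (k : Fin d → ℤ) : ℝ :=
  if k = 0 then ρ else 1 / Real.Gamma α *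
    ∫ t in Ioi (0 : ℝ), t ^ (α - 1) * Real.exp (-(t / 2) * ∑ i, (k i : ℝ) ^ 2)

lemma covCoeff_nonneg {α ρ : ℝ} (hρ : 0 ≤ ρ) (hα : 0 < α) (k : Fin d → ℤ) :
    0 ≤ covCoeff α ρ k := by
  unfold covCoeff
  split_ifs
  · exact hρ
  · have := Real.Gamma_pos_of_pos hα
    refine mul_nonneg (by positivity) (setIntegral_nonneg measurableSet_Ioi fun t ht => ?_)
    exact mul_nonneg (Real.rpow_nonneg (le_of_lt ht) _) (Real.exp_pos _).le

/-- The hypothesis for Fubini: integrating in space first replaces the small-time heat kernel by its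
mass one, leaving t^(α-1) on (0,1]. -/
lemma integrable_cov_integrand {α : ℝ} (hα : 0 < α) (hαd : α < (d : ℝ) / 2) (k : Fin d → ℤ) :
    Integrable (fun p : (Fin d → ℝ) × ℝ =>
      ((p.2 ^ (α - 1) * (heat p.2 p.1 - 1 / (2 * Real.pi) ^ d) : ℝ) : ℂ) *
        Complex.exp (-(Complex.I * ((∑ i, (k i : ℝ) * p.1 i : ℝ) : ℂ))))
      ((volume.restrict (torus d)).prod (volume.restrict (Ioi (0 : ℝ)))) := by
  obtain ⟨A, hA, h⟩ := exists_lintegral_enorm_le hα hαd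
  have hm : Measurable (fun p : (Fin d → ℝ) × ℝ =>
      p.2 ^ (α - 1) * (heat p.2 p.1 - 1 / (2 * Real.pi) ^ d)) := by
    have := measurable_heat.comp (f := fun p : (Fin d → ℝ) × ℝ => (p.2, p.1)) (by fun_prop)
    exact (by fun_prop : Measurable fun p : (Fin d → ℝ) × ℝ => p.2 ^ (α - 1)).mul
      (this.sub_const _)
  have hm2 : Measurable (fun p : (Fin d → ℝ) × ℝ =>
      ENNReal.ofReal (p.2 ^ (α - 1)) * eheat p.2 p.1) :=
    (by fun_prop : Measurable fun p : (Fin d → ℝ) × ℝ => ENNReal.ofReal (p.2 ^ (α - 1))).mul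
      (measurable_eheat.comp (f := fun p : (Fin d → ℝ) × ℝ => (p.2, p.1)) (by fun_prop))
  refine ⟨((Complex.measurable_ofReal.comp hm).mul (by fun_prop)).aestronglyMeasurable, ?_⟩
  unfold HasFiniteIntegral
  have e : ∀ p : (Fin d → ℝ) × ℝ,
      ‖((p.2 ^ (α - 1) * (heat p.2 p.1 - 1 / (2 * Real.pi) ^ d) : ℝ) : ℂ) *
        Complex.exp (-(Complex.I * ((∑ i, (k i : ℝ) * p.1 i : ℝ) : ℂ)))‖ₑ =
      ‖p.2 ^ (α - 1) * (heat p.2 p.1 - 1 / (2 * Real.pi) ^ d)‖ₑ := by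
    intro p
    rw [enorm_mul, ← ofReal_norm (Complex.exp _), Complex.norm_exp]
    rw [← ofReal_norm, Complex.norm_real, ofReal_norm]
    simp
  simp_rw [e]
  rw [lintegral_prod _ hm.enorm.aemeasurable]
  refine (lintegral_mono h).trans_lt ?_
  rw [lintegral_add_left measurable_const, setLIntegral_const,
    lintegral_lintegral_swap hm2.aemeasurable]
  refine ENNReal.add_lt_top.2 ⟨ENNReal.mul_lt_top ENNReal.ofReal_lt_top
    volume_torus_ne_top.lt_top, ?_⟩
  have h2 : ∫⁻ t in Ioc (0 : ℝ) 1, ∫⁻ x in torus d, ENNReal.ofReal (t ^ (α - 1)) * eheat t x =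
      ∫⁻ t in Ioc (0 : ℝ) 1, ENNReal.ofReal (t ^ (α - 1)) := by
    refine setLIntegral_congr_fun measurableSet_Ioc fun t ht => ?_
    rw [lintegral_const_mul' _ _ ENNReal.ofReal_ne_top]
    have := lintegral_eheat (d := d) ht.1 0
    simp only [sub_zero] at this
    rw [this, mul_one]
  rw [h2, lintegral_Ioc_rpow hα one_pos]
  exact ENNReal.ofReal_lt_top

/-- After exchanging integrals, each mode of the heat kernel is a pure exponential. Subtracting the
mean removes the zero mode, so ρ alone supplies the coefficient at k = 0. -/
lemma fourierCoeffTorus_cov {α ρ : ℝ} (hα : 0 < α) (hαd : α < (d : ℝ) / 2)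
    (k : Fin d → ℤ) : fourierCoeffTorus (cov α ρ) k =
      (((2 * Real.pi) ^ (-(d : ℝ) / 2) * covCoeff α ρ k : ℝ) : ℂ) := by
  have hpi := Real.pi_pos
  have hI := integrable_cov_integrand hα hαd k
  set c : ℝ := 1 / (2 * Real.pi) ^ d with hc
  set e : (Fin d → ℝ) → ℂ := fun x =>
    Complex.exp (-(Complex.I * ((∑ i, (k i : ℝ) * x i : ℝ) : ℂ))) with he
  have he_int : IntegrableOn e (torus d) := by
    refine Continuous.integrableOn_Icc ?_
    simp only [he]; fun_prop
  have h1 : ∀ x, (cov α ρ x : ℂ) * e x = ((ρ * c : ℝ) : ℂ) * e x + ((1 / Real.Gamma α : ℝ) : ℂ) *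
      ∫ t in Ioi (0 : ℝ), ((t ^ (α - 1) * (heat t x - c) : ℝ) : ℂ) * e x := by
    intro x
    rw [integral_mul_const, integral_complex_ofReal, cov, hc]
    push_cast; ring
  have h2 : ∀ t ∈ Ioi (0 : ℝ),
      ∫ x in torus d, ((t ^ (α - 1) * (heat t x - c) : ℝ) : ℂ) * e x =
      if k = 0 then 0 else ((t ^ (α - 1) * Real.exp (-(t / 2) * ∑ i, (k i : ℝ) ^ 2) : ℝ) : ℂ) := by
    intro t ht
    have h3 := heat_fourierCoeff (d := d) ht 0 k
    have hheat := integrable_heat (d := d) ht 0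
    simp only [sub_zero, Pi.zero_apply, mul_zero, Finset.sum_const_zero, Complex.ofReal_zero]
      at h3 hheat
    have hhe : IntegrableOn (fun x => (heat t x : ℂ) * e x) (torus d) := by
      refine Integrable.mul_bdd (c := 1) hheat.ofReal he_int.aestronglyMeasurable
        (ae_of_all _ fun x => ?_)
      simp only [he]
      rw [Complex.norm_exp]; simp
    have h4 : ∀ x, ((t ^ (α - 1) * (heat t x - c) : ℝ) : ℂ) * e x =
        ((t ^ (α - 1) : ℝ) : ℂ) * ((heat t x : ℂ) * e x - (c : ℂ) * e x) := by
      intro x; push_cast; ring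
    simp_rw [h4]
    rw [integral_const_mul, integral_sub hhe (he_int.const_mul _), integral_const_mul, h3,
      integral_torus_exp]
    split_ifs with h0
    · subst h0
      rw [← Complex.ofReal_mul, hc]
      have : 1 / (2 * Real.pi) ^ d * (2 * Real.pi) ^ d = 1 := by field_simp
      rw [this]; simp
    · simp
  have h5 : ∫ x in torus d, (cov α ρ x : ℂ) * e x = ((covCoeff α ρ k : ℝ) : ℂ) := by
    simp_rw [h1]
    rw [integral_add (he_int.const_mul _) (hI.integral_prod_left.const_mul _),
      integral_const_mul, integral_const_mul, integral_integral_swap hI,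
      setIntegral_congr_fun measurableSet_Ioi h2, integral_torus_exp, covCoeff]
    split_ifs with h0
    · rw [← Complex.ofReal_mul, hc]
      have : ρ * (1 / (2 * Real.pi) ^ d) * (2 * Real.pi) ^ d = ρ := by field_simp
      rw [this]; simp
    · rw [integral_complex_ofReal]
      push_cast; ring
  rw [fourierCoeffTorus, h5]
  push_cast; rfl

lemma k₁_eq {α ρ : ℝ} (hα : 0 < α) (hαd : α < (d : ℝ) / 2) (s : ℝ) :
    k₁ d α ρ s = ∑' k : Fin d → ℤ, (2 * Real.pi) ^ (-(d : ℝ) / 2) * covCoeff α ρ k *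
      Real.exp (-s * ∑ i, (k i : ℝ) ^ 2) := by
  unfold k₁
  simp_rw [fourierCoeffTorus_cov hα hαd, Complex.ofReal_re]

lemma k₁_nonneg {α ρ : ℝ} (hρ : 0 ≤ ρ) (hα : 0 < α) (hαd : α < (d : ℝ) / 2) (s : ℝ) :
    0 ≤ k₁ d α ρ s := by
  have hpi := Real.pi_pos
  rw [k₁_eq hα hαd]
  refine tsum_nonneg fun k => ?_
  have := covCoeff_nonneg hρ hα k
  positivity

lemma measurable_k₁ (α ρ : ℝ) : Measurable (k₁ d α ρ) := by
  unfold k₁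
  exact Measurable.tsum fun k => by fun_prop

lemma tsum_ite_exp_eq {u : ℝ} (hu : 0 < u) :
    ∑' k : Fin d → ℤ, (if k = 0 then 0 else ENNReal.ofReal (Real.exp (-u * ∑ i, (k i : ℝ) ^ 2))) =
      ENNReal.ofReal (theta u ^ d - 1) := by
  have h1 : ∑' k : Fin d → ℤ, ENNReal.ofReal (Real.exp (-u * ∑ i, (k i : ℝ) ^ 2)) =
      ENNReal.ofReal (theta u ^ d) := by
    have : ∀ k : Fin d → ℤ, ENNReal.ofReal (Real.exp (-u * ∑ i, (k i : ℝ) ^ 2)) =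
        ∏ i, ENNReal.ofReal (Real.exp (-u * (k i : ℝ) ^ 2)) := by
      intro k
      rw [Finset.mul_sum, Real.exp_sum, ENNReal.ofReal_prod_of_nonneg
        (fun _ _ => (Real.exp_pos _).le)]
    simp_rw [this]
    rw [← prod_tsum_eq_tsum_prod (fun (_ : Fin d) (n : ℤ) =>
        ENNReal.ofReal (Real.exp (-u * (n : ℝ) ^ 2))),
      ← ENNReal.ofReal_tsum_of_nonneg (fun _ => (Real.exp_pos _).le) (summable_theta hu)]
    simp only [Finset.prod_const, Finset.card_univ, Fintype.card_fin]
    rw [← ENNReal.ofReal_pow (tsum_nonneg fun _ => (Real.exp_pos _).le)]; rfl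
  rw [ENNReal.tsum_eq_add_tsum_ite 0] at h1
  rw [ENNReal.ofReal_sub _ zero_le_one, ← h1]
  simp

/-- Summing over k inside the time integral gives θ(s+t/2)^d - 1, which is at most a multiple of
(2s+t)^(-d/2); the time integral is the one already met for the covariance. -/
lemma exists_k₁_le {α ρ : ℝ} (hρ : 0 ≤ ρ) (hα : 0 < α) (hαd : α < (d : ℝ) / 2) :
    ∃ C : ℝ, 0 < C ∧ ∀ s : ℝ, 0 < s → k₁ d α ρ s ≤ C * (1 + s ^ (α - (d : ℝ) / 2)) := by
  have hpi := Real.pi_pos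
  have hΓ := Real.Gamma_pos_of_pos hα
  have hd : 0 < d := by
    rcases Nat.eq_zero_or_pos d with h | h
    · subst h; norm_num at hαd; linarith
    · exact h
  obtain ⟨C, hC, hth⟩ := exists_theta_pow_sub_one_le hd
  obtain ⟨B, hB, hint⟩ := exists_lintegral_rpow_mul_add_rpow_le hα hαd
  set c : ℝ := (2 * Real.pi) ^ (-(d : ℝ) / 2) with hc
  have hc0 : 0 < c := by positivity
  set g : ℝ := 1 / Real.Gamma α with hg
  have hg0 : 0 < g := by positivity
  set D : ℝ := (d : ℝ) / 2 with hD
  have hterm : ∀ s : ℝ, 0 < s → ∀ k : Fin d → ℤ, ENNReal.ofReal (c * covCoeff α ρ k *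
      Real.exp (-s * ∑ i, (k i : ℝ) ^ 2)) ≤
      (if k = 0 then ENNReal.ofReal (c * ρ) else 0) + ENNReal.ofReal (c * g) *
        ∫⁻ t in Ioi (0 : ℝ), ENNReal.ofReal (t ^ (α - 1)) *
          (if k = 0 then 0 else
            ENNReal.ofReal (Real.exp (-(s + t / 2) * ∑ i, (k i : ℝ) ^ 2))) := by
    intro s hs k
    by_cases h0 : k = 0
    · subst h0; simp [covCoeff]
    · simp only [h0, if_false, zero_add, covCoeff]
      rw [← hg, show ∀ I E : ℝ, c * (g * I) * E = (c * g) * (E * I) by intros; ring,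
        ENNReal.ofReal_mul (by positivity)]
      refine mul_le_mul_right ?_ _
      rw [ENNReal.ofReal_mul (Real.exp_pos _).le]
      have h1 : ENNReal.ofReal
          (∫ t in Ioi (0 : ℝ), t ^ (α - 1) * Real.exp (-(t / 2) * ∑ i, (k i : ℝ) ^ 2)) ≤
          ∫⁻ t in Ioi (0 : ℝ),
            ENNReal.ofReal (t ^ (α - 1) * Real.exp (-(t / 2) * ∑ i, (k i : ℝ) ^ 2)) := by
        refine (Real.ofReal_le_enorm _).trans ((enorm_integral_le_lintegral_enorm _).trans_eq ?_)
        refine setLIntegral_congr_fun measurableSet_Ioi fun t ht => ?_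
        exact Real.enorm_eq_ofReal (mul_nonneg (Real.rpow_nonneg (le_of_lt ht) _)
          (Real.exp_pos _).le)
      refine (mul_le_mul_right h1 _).trans_eq ?_
      rw [← lintegral_const_mul' _ _ ENNReal.ofReal_ne_top]
      refine setLIntegral_congr_fun measurableSet_Ioi fun t ht => ?_
      rw [ENNReal.ofReal_mul (Real.rpow_nonneg (le_of_lt ht) _), mul_left_comm,
        ← ENNReal.ofReal_mul (Real.exp_pos _).le, ← Real.exp_add]
      congr 3; ring
  refine ⟨c * ρ + c * g * (C * 2 ^ D * B), by positivity, fun s hs => ?_⟩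
  have hsD : 0 < s ^ (α - D) := Real.rpow_pos_of_pos hs _
  have hk : k₁ d α ρ s = (∑' k : Fin d → ℤ, ENNReal.ofReal (c * covCoeff α ρ k *
      Real.exp (-s * ∑ i, (k i : ℝ) ^ 2))).toReal := by
    rw [k₁_eq hα hαd, ENNReal.tsum_toReal_eq (fun _ => ENNReal.ofReal_ne_top)]
    refine tsum_congr fun k => ?_
    have := covCoeff_nonneg hρ hα k
    rw [ENNReal.toReal_ofReal (by positivity)]
  rw [hk]
  refine ENNReal.toReal_le_of_le_ofReal (by positivity) ?_
  calc _ ≤ ∑' k : Fin d → ℤ, ((if k = 0 then ENNReal.ofReal (c * ρ) else 0) +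
          ENNReal.ofReal (c * g) * ∫⁻ t in Ioi (0 : ℝ), ENNReal.ofReal (t ^ (α - 1)) *
          (if k = 0 then 0 else
            ENNReal.ofReal (Real.exp (-(s + t / 2) * ∑ i, (k i : ℝ) ^ 2)))) :=
        ENNReal.tsum_le_tsum (hterm s hs)
    _ = ENNReal.ofReal (c * ρ) + ENNReal.ofReal (c * g) *
          ∫⁻ t in Ioi (0 : ℝ), ENNReal.ofReal (t ^ (α - 1)) *
            ENNReal.ofReal (theta (s + t / 2) ^ d - 1) := by
        rw [ENNReal.tsum_add, tsum_ite_eq, ENNReal.tsum_mul_left, ← lintegral_tsum]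
        · congr 2
          refine setLIntegral_congr_fun measurableSet_Ioi fun t ht => ?_
          have ht' : (0 : ℝ) < t := ht
          rw [ENNReal.tsum_mul_left, tsum_ite_exp_eq (by positivity)]
        · intro k
          split_ifs
          · simp
          · fun_prop
    _ ≤ ENNReal.ofReal (c * ρ) + ENNReal.ofReal (c * g) *
          ∫⁻ t in Ioi (0 : ℝ), ENNReal.ofReal (C * 2 ^ D) *
            ENNReal.ofReal (t ^ (α - 1) * (2 * s + t) ^ (-D)) := by
        refine add_le_add le_rfl (mul_le_mul_right ?_ _)
        refine setLIntegral_mono' measurableSet_Ioi fun t ht => ?_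
        have ht' : (0 : ℝ) < t := ht
        rw [← ENNReal.ofReal_mul (by positivity), ← ENNReal.ofReal_mul (by positivity)]
        refine ENNReal.ofReal_le_ofReal ?_
        rw [mul_left_comm]
        refine mul_le_mul_of_nonneg_left ((hth (s + t / 2) (by positivity)).trans_eq ?_)
          (by positivity)
        rw [neg_div, ← hD, show s + t / 2 = (2 * s + t) / 2 by ring,
          Real.div_rpow (by positivity) (by norm_num), Real.rpow_neg (by norm_num : (0:ℝ) ≤ 2),
          div_inv_eq_mul]
        ring
    _ ≤ ENNReal.ofReal (c * ρ) + ENNReal.ofReal (c * g) * (ENNReal.ofReal (C * 2 ^ D) *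
          ENNReal.ofReal (B * s ^ (α - D))) := by
        refine add_le_add le_rfl (mul_le_mul_right ?_ _)
        rw [lintegral_const_mul _ (by fun_prop)]
        refine mul_le_mul_right ((hint (2 * s) (by positivity)).trans ?_) _
        refine ENNReal.ofReal_le_ofReal (mul_le_mul_of_nonneg_left ?_ hB.le)
        exact Real.rpow_le_rpow_of_nonpos hs (by linarith) (by linarith)
    _ ≤ _ := by
        rw [← ENNReal.ofReal_mul (by positivity), ← ENNReal.ofReal_mul (by positivity),
          ← ENNReal.ofReal_add (by positivity) (by positivity)]
        refine ENNReal.ofReal_le_ofReal ?_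
        have h1 : 0 ≤ c * ρ * s ^ (α - D) := by positivity
        have h2 : 0 ≤ c * g * (C * 2 ^ D * B) := by positivity
        nlinarith

/-- Scaling by √s extracts the power of s. The remaining constant is a Gamma integral in polar
coordinates, positive because α < d/2. -/
lemma exists_k₂_eq {α : ℝ} (hα : 0 < α) (hαd : α < (d : ℝ) / 2) :
    ∃ c : ℝ, 0 < c ∧ ∀ s : ℝ, 0 < s → k₂ d α s = c * s ^ (α - (d : ℝ) / 2) := by
  have hd : 0 < d := by
    rcases Nat.eq_zero_or_pos d with h | h
    · subst h; norm_num at hαd; linarith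
    · exact h
  have : Nonempty (Fin d) := ⟨⟨0, hd⟩⟩
  have : Nontrivial (EuclideanSpace ℝ (Fin d)) := by
    refine Module.nontrivial_of_finrank_pos (R := ℝ) ?_
    simpa using hd
  set F : EuclideanSpace ℝ (Fin d) → ℝ :=
    fun ξ => ‖ξ‖ ^ (-2 * α) * Real.exp (-(‖ξ‖ ^ 2 / 2)) with hF
  have hΓ := Real.Gamma_pos_of_pos hα
  have hΓ' : 0 < Real.Gamma ((d : ℝ) / 2 - α) := Real.Gamma_pos_of_pos (by linarith)
  have hpos : 0 < ∫ ξ, F ξ := by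
    have h1 := integral_fun_norm_addHaar (volume : Measure (EuclideanSpace ℝ (Fin d)))
      (fun r : ℝ => r ^ (-2 * α) * Real.exp (-(r ^ 2 / 2)))
    have h2 : ∫ y in Ioi (0 : ℝ), y ^ (d - 1) • (y ^ (-2 * α) * Real.exp (-(y ^ 2 / 2))) =
        ∫ y in Ioi (0 : ℝ), y ^ ((d : ℝ) - 1 - 2 * α) * Real.exp (-(1 / 2) * y ^ (2 : ℝ)) := by
      refine setIntegral_congr_fun measurableSet_Ioi fun y hy => ?_
      simp only [smul_eq_mul]
      rw [← mul_assoc, ← Real.rpow_natCast, ← Real.rpow_add hy, Nat.cast_sub hd]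
      congr 2
      · push_cast; ring
      · rw [Real.rpow_two]; ring
    rw [finrank_euclideanSpace_fin, h2, integral_rpow_mul_exp_neg_mul_rpow (by norm_num)
      (by linarith) (by norm_num)] at h1
    simp only [hF]
    rw [h1]
    have hb : 0 < (volume : Measure (EuclideanSpace ℝ (Fin d))).real (Metric.ball 0 1) :=
      ENNReal.toReal_pos (Metric.measure_ball_pos _ _ one_pos).ne' measure_ball_lt_top.ne
    have hG : 0 < Real.Gamma (((d : ℝ) - 1 - 2 * α + 1) / 2) :=
      Real.Gamma_pos_of_pos (by linarith)
    simp only [smul_eq_mul, nsmul_eq_mul]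
    positivity
  refine ⟨2 ^ (2 * α - (d : ℝ) / 2) * Real.Gamma α / Real.Gamma ((d : ℝ) / 2 - α) * ∫ ξ, F ξ,
    by positivity, fun s hs => ?_⟩
  have h1 : ∀ ξ : EuclideanSpace ℝ (Fin d),
      rieszFourier d α ξ * Real.exp (-(s * ‖ξ‖ ^ 2 / 2)) =
      2 ^ (2 * α - (d : ℝ) / 2) * Real.Gamma α / Real.Gamma ((d : ℝ) / 2 - α) * s ^ α *
        F (Real.sqrt s • ξ) := by
    intro ξ
    simp only [hF, rieszFourier, norm_smul, Real.norm_of_nonneg (Real.sqrt_nonneg s)]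
    rw [Real.mul_rpow (Real.sqrt_nonneg s) (norm_nonneg _), mul_pow, Real.sq_sqrt hs.le,
      Real.sqrt_eq_rpow, ← Real.rpow_mul hs.le]
    have : s ^ α * s ^ (1 / 2 * (-2 * α)) = 1 := by
      rw [← Real.rpow_add hs]; ring_nf; simp
    linear_combination (-(2 ^ (2 * α - (d : ℝ) / 2) * Real.Gamma α / Real.Gamma ((d : ℝ) / 2 - α) *
      ‖ξ‖ ^ (-2 * α) * Real.exp (-(s * ‖ξ‖ ^ 2 / 2)))) * this
  unfold k₂
  simp_rw [h1]
  rw [integral_const_mul, Measure.integral_comp_smul, finrank_euclideanSpace_fin, smul_eq_mul,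
    abs_of_pos (by positivity), Real.sqrt_eq_rpow, ← Real.rpow_natCast, ← Real.rpow_mul hs.le,
    ← Real.rpow_neg hs.le, sub_eq_add_neg α, Real.rpow_add hs,
    show -(1 / 2 * (d : ℝ)) = -((d : ℝ) / 2) by ring]
  ring

lemma measurable_k₂ (d : ℕ) (α : ℝ) : Measurable (k₂ d α) := by
  unfold k₂ rieszFourier
  have : StronglyMeasurable (Function.uncurry fun (s : ℝ) (ξ : EuclideanSpace ℝ (Fin d)) =>
      2 ^ (2 * α - (d : ℝ) / 2) * Real.Gamma α / Real.Gamma ((d : ℝ) / 2 - α) *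
    ‖ξ‖ ^ (-2 * α) * Real.exp (-(s * ‖ξ‖ ^ 2 / 2))) := by
    refine Measurable.stronglyMeasurable ?_
    unfold Function.uncurry
    fun_prop
  exact this.integral_prod_right.measurable

end TorusPAM

namespace TorusPAM

/-! ### The iterated integrals `h` -/

lemma measurable_intervalIntegral {X : Type*} [MeasurableSpace X] {f : X × ℝ → ℝ}
    (hf : Measurable f) {b : X → ℝ} (hb : Measurable b) :
    Measurable fun x => ∫ s in (0 : ℝ)..b x, f (x, s) := by
  have key : ∀ l u : X → ℝ, Measurable l → Measurable u →
      Measurable fun x => ∫ s in Ioc (l x) (u x), f (x, s) := by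
    intro l u hl hu
    have hS : MeasurableSet {p : X × ℝ | p.2 ∈ Ioc (l p.1) (u p.1)} :=
      (measurableSet_lt (hl.comp measurable_fst) measurable_snd).inter
        (measurableSet_le measurable_snd (hu.comp measurable_fst))
    have h1 : ∀ x, ∫ s in Ioc (l x) (u x), f (x, s) =
        ∫ s, {p : X × ℝ | p.2 ∈ Ioc (l p.1) (u p.1)}.indicator f (x, s) := by
      intro x
      rw [← integral_indicator measurableSet_Ioc]
      rfl
    simp_rw [h1]
    exact ((hf.indicator hS).stronglyMeasurable.integral_prod_right' (ν := volume)).measurable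
  exact (key _ _ measurable_const hb).sub (key _ _ hb measurable_const)

/-- The weight `k₁ + k₂ + 1` of the recursion for `h`. -/
noncomputable def weight (d : ℕ) (α ρ s : ℝ) : ℝ := k₁ d α ρ s + k₂ d α s + 1

variable {d : ℕ} {α ρ : ℝ}

lemma measurable_weight : Measurable (weight d α ρ) :=
  ((measurable_k₁ α ρ).add (measurable_k₂ d α)).add_const 1

/-- The lower bound uses only k₂ and the constant 1, with k₁ ≥ 0 discarded; k₁ matters only in the
upper bound. -/
lemma exists_weight_bounds (hρ : 0 ≤ ρ) (hα : 0 < α) (hαd : α < (d : ℝ) / 2) :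
    ∃ c C : ℝ, 0 < c ∧ 0 < C ∧ ∀ s : ℝ, 0 < s →
      c * (1 + s ^ (α - (d : ℝ) / 2)) ≤ weight d α ρ s ∧
      weight d α ρ s ≤ C * (1 + s ^ (α - (d : ℝ) / 2)) := by
  obtain ⟨C₁, hC₁, h1⟩ := exists_k₁_le hρ hα hαd
  obtain ⟨c₂, hc₂, h2⟩ := exists_k₂_eq hα hαd
  refine ⟨min c₂ 1, C₁ + c₂ + 1, by positivity, by positivity, fun s hs => ?_⟩
  have hp : 0 < s ^ (α - (d : ℝ) / 2) := Real.rpow_pos_of_pos hs _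
  have h3 := k₁_nonneg hρ hα hαd s
  have h4 := h1 s hs
  rw [weight, h2 s hs]
  constructor
  · have e1 := mul_le_mul_of_nonneg_right (min_le_left c₂ 1) hp.le
    have e2 := min_le_right c₂ 1
    linarith
  · have : 0 ≤ c₂ := hc₂.le
    nlinarith

lemma weight_nonneg (hρ : 0 ≤ ρ) (hα : 0 < α) (hαd : α < (d : ℝ) / 2) {s : ℝ} (hs : 0 < s) :
    0 ≤ weight d α ρ s := by
  obtain ⟨c, C, hc, hC, h⟩ := exists_weight_bounds hρ hα hαd
  exact le_trans (mul_nonneg hc.le (by positivity)) (h s hs).1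

/-- Dalang's condition says exactly that α - d/2 > -1, so the singularity at 0 is integrable. -/
lemma intervalIntegrable_weight (hρ : 0 ≤ ρ) (hα : 0 < α) (hαd : α < (d : ℝ) / 2)
    (hDalang : (d : ℝ) < 2 * (α + 1)) {t : ℝ} (ht : 0 ≤ t) :
    IntervalIntegrable (weight d α ρ) volume 0 t := by
  obtain ⟨c, C, hc, hC, h⟩ := exists_weight_bounds hρ hα hαd
  have h1 : IntervalIntegrable (fun s : ℝ => C * (1 + s ^ (α - (d : ℝ) / 2))) volume 0 t :=
    (intervalIntegrable_const.add
      (intervalIntegral.intervalIntegrable_rpow' (by linarith))).const_mul C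
  refine h1.mono_fun measurable_weight.aestronglyMeasurable ?_
  rw [uIoc_of_le ht]
  refine (ae_restrict_iff' measurableSet_Ioc).2 (ae_of_all _ fun s hs => ?_)
  beta_reduce
  rw [Real.norm_of_nonneg (weight_nonneg hρ hα hαd hs.1)]
  exact (h s hs.1).2.trans (le_abs_self _)

/-- The Laplace transform of the weight is small at infinity. -/
lemma exists_laplace_weight_le (hρ : 0 ≤ ρ) (hα : 0 < α) (hαd : α < (d : ℝ) / 2)
    (hDalang : (d : ℝ) < 2 * (α + 1)) {κ : ℝ} (hκ : 0 < κ) :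
    ∃ γ : ℝ, 0 < γ ∧ ∀ t : ℝ, 0 ≤ t →
      ∫ s in (0 : ℝ)..t, Real.exp (-(γ * s)) * weight d α ρ s ≤ κ := by
  obtain ⟨c, C, hc, hC, h⟩ := exists_weight_bounds hρ hα hαd
  set a : ℝ := 1 + (α - (d : ℝ) / 2) with ha
  have ha0 : 0 < a := by linarith
  have hlim : Filter.Tendsto (fun γ : ℝ => C * ((1 / γ) ^ (1 : ℝ) * Real.Gamma 1 +
      (1 / γ) ^ a * Real.Gamma a)) Filter.atTop (nhds 0) := by
    have h1 : ∀ b : ℝ, 0 < b →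
        Filter.Tendsto (fun γ : ℝ => (1 / γ) ^ b) Filter.atTop (nhds 0) := by
      intro b hb
      have := (tendsto_rpow_neg_atTop hb)
      refine this.congr' ?_
      filter_upwards [Filter.eventually_ge_atTop 0] with γ hγ
      rw [one_div, Real.inv_rpow hγ, Real.rpow_neg hγ]
    have := (((h1 1 one_pos).mul_const (Real.Gamma 1)).add
      ((h1 a ha0).mul_const (Real.Gamma a))).const_mul C
    simpa using this
  obtain ⟨γ, hγκ, hγ⟩ := ((hlim.eventually (gt_mem_nhds hκ)).and
    (Filter.eventually_gt_atTop (0 : ℝ))).exists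
  refine ⟨γ, hγ, fun t ht => ?_⟩
  have hint : ∀ b : ℝ, 0 < b →
      IntegrableOn (fun s : ℝ => s ^ (b - 1) * Real.exp (-(γ * s))) (Ioi 0) := by
    intro b hb
    -- A non-integrable function has Bochner integral 0, which contradicts the positive Gamma value.
    by_contra hcon
    have h0 := Real.integral_rpow_mul_exp_neg_mul_Ioi hb hγ
    rw [integral_undef hcon] at h0
    have := Real.Gamma_pos_of_pos hb
    have : 0 < (1 / γ) ^ b * Real.Gamma b := by positivity
    linarith
  have hsum : IntegrableOn (fun s : ℝ => C * (s ^ ((1 : ℝ) - 1) * Real.exp (-(γ * s)) +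
      s ^ (a - 1) * Real.exp (-(γ * s)))) (Ioi 0) :=
    ((hint 1 one_pos).add (hint a ha0)).const_mul C
  have hw : IntervalIntegrable (fun s => Real.exp (-(γ * s)) * weight d α ρ s) volume 0 t :=
    (intervalIntegrable_weight hρ hα hαd hDalang ht).continuousOn_mul (by fun_prop)
  calc ∫ s in (0 : ℝ)..t, Real.exp (-(γ * s)) * weight d α ρ s
      = ∫ s in Ioc 0 t, Real.exp (-(γ * s)) * weight d α ρ s :=
        intervalIntegral.integral_of_le ht
    _ ≤ ∫ s in Ioc 0 t, C * (s ^ ((1 : ℝ) - 1) * Real.exp (-(γ * s)) +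
          s ^ (a - 1) * Real.exp (-(γ * s))) := by
        refine setIntegral_mono_on hw.1 (hsum.mono_set Ioc_subset_Ioi_self) measurableSet_Ioc
          fun s hs => ?_
        refine (mul_le_mul_of_nonneg_left (h s hs.1).2 (Real.exp_pos _).le).trans_eq ?_
        rw [sub_self, Real.rpow_zero, ha, add_sub_cancel_left]; ring
    _ ≤ ∫ s in Ioi (0 : ℝ), C * (s ^ ((1 : ℝ) - 1) * Real.exp (-(γ * s)) +
          s ^ (a - 1) * Real.exp (-(γ * s))) := by
        refine setIntegral_mono_set hsum ?_ (LE.le.eventuallyLE Ioc_subset_Ioi_self)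
        refine (ae_restrict_iff' measurableSet_Ioi).2 (ae_of_all _ fun s hs => ?_)
        have hs' : (0 : ℝ) < s := hs
        simp only [Pi.zero_apply]
        positivity
    _ = C * ((1 / γ) ^ (1 : ℝ) * Real.Gamma 1 + (1 / γ) ^ a * Real.Gamma a) := by
        rw [integral_const_mul, integral_add (hint 1 one_pos) (hint a ha0),
          Real.integral_rpow_mul_exp_neg_mul_Ioi one_pos hγ,
          Real.integral_rpow_mul_exp_neg_mul_Ioi ha0 hγ]
    _ ≤ κ := hγκ.le

lemma h_succ (n : ℕ) (t : ℝ) :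
    h d α ρ (n + 1) t = ∫ s in (0 : ℝ)..t, h d α ρ n (t - s) * weight d α ρ s := rfl

lemma measurable_h (n : ℕ) : Measurable (h d α ρ n) := by
  induction n with
  | zero => exact measurable_const
  | succ n ih =>
    exact measurable_intervalIntegral
      (f := fun p : ℝ × ℝ => h d α ρ n (p.1 - p.2) * weight d α ρ p.2)
      ((ih.comp (by fun_prop)).mul (measurable_weight.comp measurable_snd)) measurable_id

/-- Two times are allowed because the monotonicity proof compares the integrands for t and t' on the
common interval [0,t]. -/
lemma intervalIntegrable_h_mul_of_monotoneOn (hρ : 0 ≤ ρ) (hα : 0 < α) (hαd : α < (d : ℝ) / 2)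
    (hDalang : (d : ℝ) < 2 * (α + 1)) {n : ℕ} (h0 : ∀ t, 0 ≤ t → 0 ≤ h d α ρ n t)
    (hmono : MonotoneOn (h d α ρ n) (Ici 0)) {t t' : ℝ} (ht : 0 ≤ t) (htt' : t ≤ t') :
    IntervalIntegrable (fun s => h d α ρ n (t' - s) * weight d α ρ s) volume 0 t := by
  refine ((intervalIntegrable_weight hρ hα hαd hDalang ht).const_mul (h d α ρ n t')).mono_fun ?_ ?_
  · exact (((measurable_h n).comp (measurable_const.sub measurable_id)).mul
      measurable_weight).aestronglyMeasurable
  · rw [uIoc_of_le ht]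
    refine (ae_restrict_iff' measurableSet_Ioc).2 (ae_of_all _ fun s hs => ?_)
    have hts : 0 ≤ t' - s := by linarith [hs.2]
    simp only [norm_mul]
    refine mul_le_mul_of_nonneg_right ?_ (norm_nonneg _)
    rw [Real.norm_of_nonneg (h0 _ hts), Real.norm_of_nonneg (h0 _ (ht.trans htt'))]
    exact hmono hts (ht.trans htt') (by linarith [hs.1])

/-- The two properties are proved in one induction: integrability of the next integrand needs both.
-/
lemma h_nonneg_and_monotoneOn (hρ : 0 ≤ ρ) (hα : 0 < α) (hαd : α < (d : ℝ) / 2)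
    (hDalang : (d : ℝ) < 2 * (α + 1)) (n : ℕ) :
    (∀ t, 0 ≤ t → 0 ≤ h d α ρ n t) ∧ MonotoneOn (h d α ρ n) (Ici 0) := by
  induction n with
  | zero => exact ⟨fun _ _ => zero_le_one, fun _ _ _ _ _ => le_rfl⟩
  | succ n ih =>
    obtain ⟨h0, hmono⟩ := ih
    have hI := fun {t t'} => intervalIntegrable_h_mul_of_monotoneOn hρ hα hαd hDalang h0 hmono
      (t := t) (t' := t')
    refine ⟨fun t ht => ?_, fun t ht t' ht' htt' => ?_⟩
    · rw [h_succ, intervalIntegral.integral_of_le ht]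
      refine setIntegral_nonneg measurableSet_Ioc fun s hs => ?_
      exact mul_nonneg (h0 _ (by linarith [hs.2])) (weight_nonneg hρ hα hαd hs.1)
    · have ht0 : 0 ≤ t := ht
      have ht0' : 0 ≤ t' := ht'
      rw [h_succ, h_succ]
      refine (intervalIntegral.integral_mono_on_of_le_Ioo ht0 (hI ht0 le_rfl) (hI ht0 htt')
        fun s hs => ?_).trans ?_
      · refine mul_le_mul_of_nonneg_right ?_ (weight_nonneg hρ hα hαd hs.1)
        exact hmono (by simp; linarith [hs.2]) (by simp; linarith [hs.2]) (by linarith)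
      · refine intervalIntegral.integral_mono_interval le_rfl ht0 htt' ?_ (hI ht0' le_rfl)
        refine (ae_restrict_iff' measurableSet_Ioc).2 (ae_of_all _ fun s hs => ?_)
        exact mul_nonneg (h0 _ (by linarith [hs.2])) (weight_nonneg hρ hα hαd hs.1)

lemma h_nonneg (hρ : 0 ≤ ρ) (hα : 0 < α) (hαd : α < (d : ℝ) / 2)
    (hDalang : (d : ℝ) < 2 * (α + 1)) (n : ℕ) {t : ℝ} (ht : 0 ≤ t) : 0 ≤ h d α ρ n t :=
  (h_nonneg_and_monotoneOn hρ hα hαd hDalang n).1 t ht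

lemma intervalIntegrable_h_mul (hρ : 0 ≤ ρ) (hα : 0 < α) (hαd : α < (d : ℝ) / 2)
    (hDalang : (d : ℝ) < 2 * (α + 1)) (n : ℕ) {t : ℝ} (ht : 0 ≤ t) :
    IntervalIntegrable (fun s => h d α ρ n (t - s) * weight d α ρ s) volume 0 t :=
  intervalIntegrable_h_mul_of_monotoneOn hρ hα hαd hDalang
    (h_nonneg_and_monotoneOn hρ hα hαd hDalang n).1
    (h_nonneg_and_monotoneOn hρ hα hαd hDalang n).2 ht le_rfl

/-- After multiplication by e^(-γt), each convolution with the weight costs at most its Laplace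
transform at γ, hence at most κ; γ does not depend on n. -/
lemma exists_h_le (hρ : 0 ≤ ρ) (hα : 0 < α) (hαd : α < (d : ℝ) / 2)
    (hDalang : (d : ℝ) < 2 * (α + 1)) {κ : ℝ} (hκ : 0 < κ) :
    ∃ γ : ℝ, ∀ (n : ℕ) (t : ℝ), 0 ≤ t → h d α ρ n t ≤ Real.exp (γ * t) * κ ^ n := by
  obtain ⟨γ, hγ, hlap⟩ := exists_laplace_weight_le hρ hα hαd hDalang hκ
  refine ⟨γ, fun n => ?_⟩
  induction n with
  | zero => intro t ht; simp only [h, pow_zero, mul_one]; exact Real.one_le_exp (by positivity)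
  | succ n ih =>
    intro t ht
    rw [h_succ]
    have hw : IntervalIntegrable (fun s => Real.exp (-(γ * s)) * weight d α ρ s) volume 0 t :=
      (intervalIntegrable_weight hρ hα hαd hDalang ht).continuousOn_mul (by fun_prop)
    calc ∫ s in (0 : ℝ)..t, h d α ρ n (t - s) * weight d α ρ s
        ≤ ∫ s in (0 : ℝ)..t,
            Real.exp (γ * t) * κ ^ n * (Real.exp (-(γ * s)) * weight d α ρ s) := by
          refine intervalIntegral.integral_mono_on_of_le_Ioo ht
            (intervalIntegrable_h_mul hρ hα hαd hDalang n ht) (hw.const_mul _) fun s hs => ?_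
          refine (mul_le_mul_of_nonneg_right (ih (t - s) (by linarith [hs.2]))
            (weight_nonneg hρ hα hαd hs.1)).trans_eq ?_
          rw [mul_sub, sub_eq_add_neg, Real.exp_add]; ring
      _ ≤ Real.exp (γ * t) * κ ^ n * κ := by
          rw [intervalIntegral.integral_const_mul]
          exact mul_le_mul_of_nonneg_left (hlap t ht) (by positivity)
      _ = _ := by ring

lemma summable_mul_h (hρ : 0 ≤ ρ) (hα : 0 < α) (hαd : α < (d : ℝ) / 2)
    (hDalang : (d : ℝ) < 2 * (α + 1)) {b t : ℝ} (hb : 0 < b) (ht : 0 ≤ t) :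
    Summable fun n : ℕ => b ^ n * h d α ρ n t := by
  obtain ⟨γ, hγ⟩ := exists_h_le hρ hα hαd hDalang (κ := 1 / (2 * b)) (by positivity)
  refine Summable.of_nonneg_of_le
    (fun n => mul_nonneg (by positivity) (h_nonneg hρ hα hαd hDalang n ht)) (fun n => ?_)
    ((summable_geometric_of_lt_one (r := 1 / 2) (by norm_num) (by norm_num)).mul_left
      (Real.exp (γ * t)))
  refine (mul_le_mul_of_nonneg_left (hγ n t ht) (by positivity)).trans_eq ?_
  rw [mul_left_comm, ← mul_pow]
  congr 2
  field_simp

/-- This absorbs the bridge singularity, which sits at both ends of (0,t), into a recursion whose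
weight is singular at one end only. -/
lemma exists_lintegral_h_mul_le (hρ : 0 ≤ ρ) (hα : 0 < α) (hαd : α < (d : ℝ) / 2)
    (hDalang : (d : ℝ) < 2 * (α + 1)) :
    ∃ C : ℝ, 0 < C ∧ ∀ (n : ℕ) (t : ℝ), 0 < t →
      ∫⁻ s in Ioo 0 t, ENNReal.ofReal (h d α ρ n s *
        (1 + (s * (t - s) / t) ^ (α - (d : ℝ) / 2))) ≤ ENNReal.ofReal (C * h d α ρ (n + 1) t) := by
  obtain ⟨c, C, hc, hC, hbd⟩ := exists_weight_bounds hρ hα hαd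
  -- The pointwise bound below uses two copies of one integrand and one of its reflection s ↦ t - s;
  -- each integrates to h_{n+1}(t), and 1/c comes from the lower bound on the weight.
  refine ⟨3 / c, by positivity, fun n t ht => ?_⟩
  obtain ⟨h0, hmono⟩ := h_nonneg_and_monotoneOn hρ hα hαd hDalang n
  set β : ℝ := (d : ℝ) / 2 - α with hβ
  have hβ0 : 0 < β := by linarith
  have hβ1 : β ≤ 1 := by linarith
  have hβn : α - (d : ℝ) / 2 = -β := by ring
  rw [hβn] at hbd ⊢
  have hI := intervalIntegrable_h_mul hρ hα hαd hDalang n ht.le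
  have hI' : IntervalIntegrable (fun s => h d α ρ n s * weight d α ρ (t - s)) volume 0 t := by
    have := (hI.comp_sub_left t).symm
    simpa using this
  have hint' : ∫ s in (0 : ℝ)..t, h d α ρ n s * weight d α ρ (t - s) = h d α ρ (n + 1) t := by
    have := intervalIntegral.integral_comp_sub_left (a := 0) (b := t)
      (fun s => h d α ρ n (t - s) * weight d α ρ s) t
    simpa [h_succ] using this
  have hJ : IntervalIntegrable (fun s => 1 / c * (2 * (h d α ρ n s * weight d α ρ (t - s)) +
      h d α ρ n (t - s) * weight d α ρ s)) volume 0 t :=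
    ((hI'.const_mul 2).add hI).const_mul _
  have hpt : ∀ s ∈ Ioo 0 t, h d α ρ n s * (1 + (s * (t - s) / t) ^ (-β)) ≤
      1 / c * (2 * (h d α ρ n s * weight d α ρ (t - s)) + h d α ρ n (t - s) * weight d α ρ s) := by
    intro s hs
    have hs0 : 0 < s := hs.1
    have hts : 0 < t - s := sub_pos.2 hs.2
    set u := s ^ (-β) with hu
    set v := (t - s) ^ (-β) with hv
    have hu0 : 0 < u := Real.rpow_pos_of_pos hs0 _
    have hv0 : 0 < v := Real.rpow_pos_of_pos hts _
    -- Since 1/σ = 1/s + 1/(t-s) and 0 < β ≤ 1, the power β is subadditive.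
    have e1 : (s * (t - s) / t) ^ (-β) ≤ u + v := by
      rw [hu, hv, Real.rpow_neg (by positivity), Real.rpow_neg hs0.le, Real.rpow_neg hts.le,
        ← Real.inv_rpow (by positivity), ← Real.inv_rpow hs0.le, ← Real.inv_rpow hts.le,
        show (s * (t - s) / t)⁻¹ = s⁻¹ + (t - s)⁻¹ by field_simp; ring]
      exact Real.rpow_add_le_add_rpow (by positivity) (by positivity) hβ0.le hβ1
    have a0 := h0 s hs0.le
    have b0 := h0 (t - s) hts.le
    -- If s ≤ t - s, then h_n(s) ≤ h_n(t-s); otherwise s^(-β) ≤ (t-s)^(-β).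
    have e2 : h d α ρ n s * u ≤ h d α ρ n s * v + h d α ρ n (t - s) * u := by
      rcases le_total s (t - s) with hle | hle
      · have := mul_le_mul_of_nonneg_right (hmono hs0.le hts.le hle) hu0.le
        have : 0 ≤ h d α ρ n s * v := by positivity
        linarith
      · have := mul_le_mul_of_nonneg_left
          (Real.rpow_le_rpow_of_nonpos hts hle (by linarith : -β ≤ 0)) a0
        have : 0 ≤ h d α ρ n (t - s) * u := by positivity
        linarith
    have e3 := mul_le_mul_of_nonneg_left (hbd (t - s) hts).1 a0
    have e4 := mul_le_mul_of_nonneg_left (hbd s hs0).1 b0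
    rw [one_div, inv_mul_eq_div, le_div_iff₀ hc]
    have e5 : h d α ρ n s * (1 + (s * (t - s) / t) ^ (-β)) ≤ h d α ρ n s * (1 + (u + v)) :=
      mul_le_mul_of_nonneg_left (by linarith) a0
    have e6 : h d α ρ n s * (1 + (u + v)) ≤
        2 * (h d α ρ n s * (1 + v)) + h d α ρ n (t - s) * (1 + u) := by linarith
    have e7 := mul_le_mul_of_nonneg_right (e5.trans e6) hc.le
    linarith
  calc ∫⁻ s in Ioo 0 t, ENNReal.ofReal (h d α ρ n s * (1 + (s * (t - s) / t) ^ (-β)))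
      ≤ ∫⁻ s in Ioo 0 t, ENNReal.ofReal (1 / c * (2 * (h d α ρ n s * weight d α ρ (t - s)) +
          h d α ρ n (t - s) * weight d α ρ s)) :=
        setLIntegral_mono' measurableSet_Ioo fun s hs => ENNReal.ofReal_le_ofReal (hpt s hs)
    _ = ENNReal.ofReal (∫ s in Ioo 0 t, 1 / c * (2 * (h d α ρ n s * weight d α ρ (t - s)) +
          h d α ρ n (t - s) * weight d α ρ s)) := by
        refine (ofReal_integral_eq_lintegral_ofReal (hJ.1.mono_set Ioo_subset_Ioc_self) ?_).symm
        refine (ae_restrict_iff' measurableSet_Ioo).2 (ae_of_all _ fun s hs => ?_)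
        have hts : 0 < t - s := sub_pos.2 hs.2
        refine le_trans (mul_nonneg (h0 s hs.1.le) ?_) (hpt s hs)
        have := Real.rpow_nonneg (x := s * (t - s) / t)
          (div_nonneg (mul_nonneg hs.1.le hts.le) ht.le) (-β)
        linarith
    _ = _ := by
        rw [← integral_Ioc_eq_integral_Ioo, ← intervalIntegral.integral_of_le ht.le,
          intervalIntegral.integral_const_mul,
          intervalIntegral.integral_add (hI'.const_mul 2) hI,
          intervalIntegral.integral_const_mul, hint', ← h_succ]
        congr 1; ring

end TorusPAM

namespace TorusPAM

/-! ### The iterated kernels -/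

variable {d : ℕ} {α ρ : ℝ}

lemma measurable_heat₂_comp {X : Type*} [MeasurableSpace X] {t : X → ℝ} {x y : X → (Fin d → ℝ)}
    (ht : Measurable t) (hx : Measurable x) (hy : Measurable y) :
    Measurable fun p => heat₂ (t p) (x p) (y p) := by
  simp_rw [heat₂_eq]
  exact measurable_heat.comp (ht.prodMk (hx.sub hy))

lemma measurable_L (n : ℕ) (x₀ x₀' : Fin d → ℝ) :
    Measurable fun q : ℝ × ((Fin d → ℝ) × (Fin d → ℝ)) =>
      L d α ρ n q.1 x₀ q.2.1 x₀' q.2.2 := by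
  induction n with
  | zero =>
    exact (measurable_heat₂_comp measurable_fst measurable_const (by fun_prop)).mul
      (measurable_heat₂_comp measurable_fst measurable_const (by fun_prop))
  | succ n ih =>
    have hF : Measurable fun r : ((ℝ × ((Fin d → ℝ) × (Fin d → ℝ))) × ℝ) ×
        ((Fin d → ℝ) × (Fin d → ℝ)) =>
        convIntegrand α ρ (L₀ d) (L d α ρ n) r.1.1.1 x₀ r.1.1.2.1 x₀' r.1.1.2.2 (r.1.2, r.2) := by
      unfold convIntegrand L₀
      refine Measurable.mul (Measurable.mul (Measurable.mul ?_ ?_) ?_) ?_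
      · exact measurable_heat₂_comp (by fun_prop) (by fun_prop) (by fun_prop)
      · exact measurable_heat₂_comp (by fun_prop) (by fun_prop) (by fun_prop)
      · exact ih.comp (f := fun r : ((ℝ × ((Fin d → ℝ) × (Fin d → ℝ))) × ℝ) ×
          ((Fin d → ℝ) × (Fin d → ℝ)) => (r.1.2, r.2)) (by fun_prop)
      · exact (measurable_cov₂ α ρ).comp measurable_snd
    have hG := (hF.stronglyMeasurable.integral_prod_right'
      (ν := volume.restrict (torus d ×ˢ torus d))).measurable
    exact measurable_intervalIntegral hG measurable_fst

lemma measurable_convIntegrand (n : ℕ) (t : ℝ) (x₀ x x₀' x' : Fin d → ℝ) :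
    Measurable (convIntegrand α ρ (L₀ d) (L d α ρ n) t x₀ x x₀' x') := by
  unfold convIntegrand L₀
  refine Measurable.mul (Measurable.mul (Measurable.mul ?_ ?_) ?_) ?_
  · exact measurable_heat₂_comp (by fun_prop) (by fun_prop) (by fun_prop)
  · exact measurable_heat₂_comp (by fun_prop) (by fun_prop) (by fun_prop)
  · exact measurable_L n x₀ x₀'
  · exact (measurable_cov₂ α ρ).comp measurable_snd

lemma measurable_eheat_comp {X : Type*} [MeasurableSpace X] (t : ℝ) {x : X → (Fin d → ℝ)}
    (hx : Measurable x) : Measurable fun p => eheat t (x p) :=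
  measurable_eheat.comp (f := fun p => (t, x p)) (measurable_const.prodMk hx)

/-- Integrating the covariance against two independent bridges from `x₀` to `x` and from `x₀'`
to `x'`. -/
lemma lintegral_bridge_le {Φ : ENNReal} {t s : ℝ} (hs : 0 < s) (hst : s < t)
    (hΦ : ∀ z a : Fin d → ℝ, ∫⁻ z' in torus d,
      eheat (s * (t - s) / t) (z' - a) * ‖cov₂ α ρ z z'‖ₑ ≤ Φ) (x₀ x x₀' x' : Fin d → ℝ) :
    ∫⁻ z in torus d ×ˢ torus d, eheat (t - s) (z.1 - x) * eheat s (x₀ - z.1) *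
        (eheat (t - s) (z.2 - x') * eheat s (x₀' - z.2) * ‖cov₂ α ρ z.1 z.2‖ₑ) ≤
      eheat t (x₀ - x) * (eheat t (x₀' - x') * Φ) := by
  have hts : 0 < t - s := sub_pos.2 hst
  have ht : 0 < t := hs.trans hst
  have hcov : Measurable fun z : (Fin d → ℝ) × (Fin d → ℝ) => ‖cov₂ α ρ z.1 z.2‖ₑ :=
    (measurable_cov₂ α ρ).enorm
  have hcz : ∀ z : Fin d → ℝ, Measurable fun z' : Fin d → ℝ => ‖cov₂ α ρ z z'‖ₑ := fun z =>
    hcov.comp (f := fun z' : Fin d → ℝ => (z, z')) (measurable_const.prodMk measurable_id)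
  obtain ⟨w, a, hw, hwa⟩ := eheat_mul hs hst x₀ x
  obtain ⟨w', a', hw', hwa'⟩ := eheat_mul hs hst x₀' x'
  have hm1 : Measurable fun z : Fin d → ℝ => eheat (t - s) (z - x) * eheat s (x₀ - z) :=
    (measurable_eheat_comp _ (by fun_prop)).mul (measurable_eheat_comp _ (by fun_prop))
  have hm2 : Measurable fun z : Fin d → ℝ => eheat (t - s) (z - x') * eheat s (x₀' - z) :=
    (measurable_eheat_comp _ (by fun_prop)).mul (measurable_eheat_comp _ (by fun_prop))
  have hmass : ∫⁻ z in torus d, eheat (t - s) (z - x) * eheat s (x₀ - z) = eheat t (x₀ - x) := by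
    rw [lintegral_eheat_mul hts hs, sub_add_cancel]
  -- Only the second bridge smooths the covariance, uniformly in z; the first then contributes just
  -- its mass.
  have hinner : ∀ z : Fin d → ℝ, ∫⁻ z' in torus d,
      eheat (t - s) (z' - x') * eheat s (x₀' - z') * ‖cov₂ α ρ z z'‖ₑ ≤
      eheat t (x₀' - x') * Φ := by
    intro z
    have e : ∀ z' : Fin d → ℝ, eheat (t - s) (z' - x') * eheat s (x₀' - z') * ‖cov₂ α ρ z z'‖ₑ =
        ∑' m, w' m * (eheat (s * (t - s) / t) (z' - a' m) * ‖cov₂ α ρ z z'‖ₑ) := by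
      intro z'
      rw [hwa' z', ← ENNReal.tsum_mul_right]
      exact tsum_congr fun m => mul_assoc _ _ _
    have hm : ∀ m, Measurable fun z' : Fin d → ℝ =>
        eheat (s * (t - s) / t) (z' - a' m) * ‖cov₂ α ρ z z'‖ₑ := fun m =>
      (measurable_eheat_comp _ (by fun_prop)).mul (hcz z)
    rw [lintegral_congr e, lintegral_tsum, ← hw', ← ENNReal.tsum_mul_right]
    · refine ENNReal.tsum_le_tsum fun m => ?_
      rw [lintegral_const_mul _ (hm m)]
      exact mul_le_mul_right (hΦ z (a' m)) _
    · intro m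
      exact ((hm m).const_mul _).aemeasurable
  rw [Measure.volume_eq_prod, ← Measure.prod_restrict, lintegral_prod]
  · calc _ ≤ ∫⁻ z in torus d, eheat (t - s) (z - x) * eheat s (x₀ - z) *
          (eheat t (x₀' - x') * Φ) := by
          refine lintegral_mono fun z => ?_
          exact (lintegral_const_mul _ (hm2.mul (hcz z))).trans_le
            (mul_le_mul_right (hinner z) _)
      _ = _ := by rw [lintegral_mul_const _ hm1, hmass]
  · exact ((hm1.comp measurable_fst).mul ((hm2.comp measurable_snd).mul hcov)).aemeasurable

/-- The inductive step: a bound on `L n` for positive times bounds the next convolution. -/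
lemma exists_lintegral_convIntegrand_le (hρ : 0 ≤ ρ) (hα : 0 < α) (hαd : α < (d : ℝ) / 2)
    (hDalang : (d : ℝ) < 2 * (α + 1)) :
    ∃ C : ℝ, 0 < C ∧ ∀ (n : ℕ) (B : ℝ), 0 ≤ B →
      (∀ s : ℝ, 0 < s → ∀ x₀ z x₀' z' : Fin d → ℝ,
        |L d α ρ n s x₀ z x₀' z'| ≤ B * (heat₂ s x₀ z * heat₂ s x₀' z') * h d α ρ n s) →
      ∀ t : ℝ, 0 < t → ∀ x₀ x x₀' x' : Fin d → ℝ,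
        ∫⁻ s in Ioo 0 t, ∫⁻ z in torus d ×ˢ torus d,
          ‖convIntegrand α ρ (L₀ d) (L d α ρ n) t x₀ x x₀' x' (s, z)‖ₑ ≤
        ENNReal.ofReal (C * B * (heat₂ t x₀ x * heat₂ t x₀' x') * h d α ρ (n + 1) t) := by
  obtain ⟨C₁, hC₁, hΦ⟩ := exists_lintegral_eheat_mul_cov₂_le (d := d) hρ hα hαd
  obtain ⟨C₂, hC₂, hh⟩ := exists_lintegral_h_mul_le hρ hα hαd hDalang
  refine ⟨C₁ * C₂, by positivity, fun n B hB hL t ht x₀ x x₀' x' => ?_⟩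
  set β : ℝ := α - (d : ℝ) / 2 with hβ
  have hstep : ∀ s ∈ Ioo 0 t, ∫⁻ z in torus d ×ˢ torus d,
      ‖convIntegrand α ρ (L₀ d) (L d α ρ n) t x₀ x x₀' x' (s, z)‖ₑ ≤
      ENNReal.ofReal (B * C₁ * (heat₂ t x₀ x * heat₂ t x₀' x')) *
        ENNReal.ofReal (h d α ρ n s * (1 + (s * (t - s) / t) ^ β)) := by
    intro s hs
    have hs0 : 0 < s := hs.1
    have hts : 0 < t - s := sub_pos.2 hs.2
    have hhn := h_nonneg hρ hα hαd hDalang n hs0.le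
    have hσ : 0 < s * (t - s) / t := by positivity
    have hσβ : 0 < (s * (t - s) / t) ^ β := Real.rpow_pos_of_pos hσ _
    have h1 : ∀ z : (Fin d → ℝ) × (Fin d → ℝ),
        ‖convIntegrand α ρ (L₀ d) (L d α ρ n) t x₀ x x₀' x' (s, z)‖ₑ ≤
        ENNReal.ofReal (B * h d α ρ n s) * (eheat (t - s) (z.1 - x) * eheat s (x₀ - z.1) *
        (eheat (t - s) (z.2 - x') * eheat s (x₀' - z.2) * ‖cov₂ α ρ z.1 z.2‖ₑ)) := by
      intro z
      have e1 : ‖L d α ρ n s x₀ z.1 x₀' z.2‖ₑ ≤ ENNReal.ofReal (B * h d α ρ n s) *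
          (eheat s (x₀ - z.1) * eheat s (x₀' - z.2)) := by
        rw [Real.enorm_eq_ofReal_abs, ← ofReal_heat hs0, ← ofReal_heat hs0,
          ← ENNReal.ofReal_mul (heat_nonneg _ _), ← ENNReal.ofReal_mul (by positivity)]
        refine ENNReal.ofReal_le_ofReal ((hL s hs0 x₀ z.1 x₀' z.2).trans_eq ?_)
        rw [heat₂_eq, heat₂_eq]; ring
      simp only [convIntegrand, L₀, enorm_mul]
      rw [heat₂_eq, heat₂_eq, Real.enorm_eq_ofReal (heat_nonneg _ _),
        Real.enorm_eq_ofReal (heat_nonneg _ _), ofReal_heat hts, ofReal_heat hts]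
      refine (mul_le_mul_left (mul_le_mul_right e1 _) _).trans_eq ?_
      ring
    refine (lintegral_mono h1).trans ?_
    rw [lintegral_const_mul' _ _ ENNReal.ofReal_ne_top]
    refine (mul_le_mul_right (lintegral_bridge_le hs0 hs.2 (hΦ _ hσ) x₀ x x₀' x') _).trans_eq ?_
    rw [← ofReal_heat ht, ← ofReal_heat ht, heat₂_eq, heat₂_eq]
    have p1 := heat_nonneg t (x₀ - x)
    have p2 := heat_nonneg t (x₀' - x')
    rw [← ENNReal.ofReal_mul p2, ← ENNReal.ofReal_mul p1, ← ENNReal.ofReal_mul (by positivity),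
      ← ENNReal.ofReal_mul (by positivity)]
    congr 1; ring
  have p1 := heat₂_nonneg t x₀ x
  have p2 := heat₂_nonneg t x₀' x'
  refine (setLIntegral_mono' measurableSet_Ioo hstep).trans ?_
  rw [lintegral_const_mul' _ _ ENNReal.ofReal_ne_top]
  refine (mul_le_mul_right (hh n t ht) _).trans_eq ?_
  rw [← ENNReal.ofReal_mul (by positivity)]
  congr 1; ring

lemma lintegral_prod_convIntegrand (n : ℕ) (t : ℝ) (x₀ x x₀' x' : Fin d → ℝ) :
    ∫⁻ q in Ioo 0 t ×ˢ (torus d ×ˢ torus d),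
      ‖convIntegrand α ρ (L₀ d) (L d α ρ n) t x₀ x x₀' x' q‖ₑ =
    ∫⁻ s in Ioo 0 t, ∫⁻ z in torus d ×ˢ torus d,
      ‖convIntegrand α ρ (L₀ d) (L d α ρ n) t x₀ x x₀' x' (s, z)‖ₑ := by
  rw [Measure.volume_eq_prod, ← Measure.prod_restrict,
    lintegral_prod _ (measurable_convIntegrand n t x₀ x x₀' x').enorm.aemeasurable]

/-- The norm inequality for Bochner integrals needs no integrability, so the induction can proceed
before convergence is known. -/
lemma enorm_conv_le (n : ℕ) {t : ℝ} (ht : 0 < t) (x₀ x x₀' x' : Fin d → ℝ) :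
    ‖L d α ρ (n + 1) t x₀ x x₀' x'‖ₑ ≤ ∫⁻ s in Ioo 0 t, ∫⁻ z in torus d ×ˢ torus d,
      ‖convIntegrand α ρ (L₀ d) (L d α ρ n) t x₀ x x₀' x' (s, z)‖ₑ := by
  simp only [L, conv]
  rw [intervalIntegral.integral_of_le ht.le, integral_Ioc_eq_integral_Ioo]
  exact (enorm_integral_le_lintegral_enorm _).trans
    (lintegral_mono fun s => enorm_integral_le_lintegral_enorm _)

lemma exists_L_bound (hρ : 0 ≤ ρ) (hα : 0 < α) (hαd : α < (d : ℝ) / 2)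
    (hDalang : (d : ℝ) < 2 * (α + 1)) :
    ∃ C : ℝ, 0 < C ∧ ∀ (n : ℕ) (t : ℝ), 0 < t → ∀ x₀ x x₀' x' : Fin d → ℝ,
      |L d α ρ n t x₀ x x₀' x'| ≤ C ^ n * (heat₂ t x₀ x * heat₂ t x₀' x') * h d α ρ n t ∧
      IntegrableOn (convIntegrand α ρ (L₀ d) (L d α ρ n) t x₀ x x₀' x')
        (Ioo 0 t ×ˢ (torus d ×ˢ torus d)) := by
  obtain ⟨C, hC, hstep⟩ := exists_lintegral_convIntegrand_le (d := d) hρ hα hαd hDalang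
  have hbound : ∀ (n : ℕ) (t : ℝ), 0 < t → ∀ x₀ x x₀' x' : Fin d → ℝ,
      |L d α ρ n t x₀ x x₀' x'| ≤ C ^ n * (heat₂ t x₀ x * heat₂ t x₀' x') * h d α ρ n t := by
    intro n
    induction n with
    | zero =>
      intro t ht x₀ x x₀' x'
      have p1 := heat₂_nonneg t x₀ x
      have p2 := heat₂_nonneg t x₀' x'
      simp only [L, L₀, h, pow_zero, one_mul, mul_one]
      rw [abs_of_nonneg (by positivity)]
    | succ n ih =>
      intro t ht x₀ x x₀' x'
      have p1 := heat₂_nonneg t x₀ x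
      have p2 := heat₂_nonneg t x₀' x'
      have p3 := h_nonneg hρ hα hαd hDalang (n + 1) ht.le
      have := (enorm_conv_le n ht x₀ x x₀' x').trans (hstep n (C ^ n) (by positivity) ih t ht x₀ x x₀' x')
      rw [Real.enorm_eq_ofReal_abs, ENNReal.ofReal_le_ofReal_iff (by positivity)] at this
      rwa [pow_succ']
  refine ⟨C, hC, fun n t ht x₀ x x₀' x' => ⟨hbound n t ht x₀ x x₀' x', ?_⟩⟩
  refine ⟨(measurable_convIntegrand n t x₀ x x₀' x').aestronglyMeasurable, ?_⟩
  unfold HasFiniteIntegral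
  rw [lintegral_prod_convIntegrand]
  exact (hstep n (C ^ n) (by positivity) (hbound n) t ht x₀ x x₀' x').trans_lt
    ENNReal.ofReal_lt_top

end TorusPAM

/-- The conclusion also records what makes the integrals and series involved meaningful: every
convolution integral is absolutely convergent, and the series for `𝓚` and `H` converge. -/
theorem proposition4p3 (d : ℕ) (α ρ : ℝ) (hρ : 0 ≤ ρ) (hα : 0 < α) (hαd : α < (d : ℝ) / 2)
    (hDalang : (d : ℝ) < 2 * (α + 1)) :
    ∃ C : ℝ, 0 < C ∧
      ∀ t : ℝ, 0 < t →
      ∀ x₀ ∈ TorusPAM.torus d, ∀ x ∈ TorusPAM.torus d,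
      ∀ x₀' ∈ TorusPAM.torus d, ∀ x' ∈ TorusPAM.torus d,
        (∀ n : ℕ, 1 ≤ n →
          MeasureTheory.IntegrableOn
            (TorusPAM.convIntegrand α ρ (TorusPAM.L d α ρ 0) (TorusPAM.L d α ρ (n - 1))
              t x₀ x x₀' x')
            (Set.Ioo 0 t ×ˢ (TorusPAM.torus d ×ˢ TorusPAM.torus d)) ∧
          IntervalIntegrable
            (fun s => TorusPAM.h d α ρ (n - 1) (t - s) *
              (TorusPAM.k₁ d α ρ s + TorusPAM.k₂ d α s + 1)) MeasureTheory.volume 0 t ∧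
          |TorusPAM.L d α ρ n t x₀ x x₀' x'| ≤
            C ^ n * (TorusPAM.heat₂ t x₀ x * TorusPAM.heat₂ t x₀' x') *
              TorusPAM.h d α ρ n t) ∧
        (∀ l : ℝ, l ≠ 0 →
          Summable (fun n : ℕ => l ^ (2 * n) * TorusPAM.L d α ρ n t x₀ x x₀' x') ∧
          Summable (fun n : ℕ => (l * C ^ (1 / 2 : ℝ)) ^ (2 * n) * TorusPAM.h d α ρ n t) ∧
          |TorusPAM.K d α ρ l t x₀ x x₀' x'| ≤
            TorusPAM.heat₂ t x₀ x * TorusPAM.heat₂ t x₀' x' *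
              TorusPAM.H d α ρ (l * C ^ (1 / 2 : ℝ)) t) := by

  obtain ⟨C, hC, hL⟩ := TorusPAM.exists_L_bound (d := d) hρ hα hαd hDalang
  refine ⟨C, hC, fun t ht x₀ _ x _ x₀' _ x' _ => ⟨fun n hn => ?_, fun l hl => ?_⟩⟩
  · obtain ⟨m, rfl⟩ : ∃ m, n = m + 1 := ⟨n - 1, by omega⟩
    rw [Nat.add_sub_cancel]
    exact ⟨(hL m t ht x₀ x x₀' x').2,
      TorusPAM.intervalIntegrable_h_mul hρ hα hαd hDalang m ht.le, (hL (m + 1) t ht x₀ x x₀' x').1⟩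
  -- Only even powers occur, so the sign of l plays no role.
  · have hpow : ∀ n : ℕ, (l * C ^ (1 / 2 : ℝ)) ^ (2 * n) = (l ^ 2 * C) ^ n := by
      intro n
      rw [pow_mul, mul_pow l, ← Real.sqrt_eq_rpow, Real.sq_sqrt hC.le]
    have hl2 : 0 < l ^ 2 := by positivity
    have hH : Summable fun n : ℕ =>
        (l * C ^ (1 / 2 : ℝ)) ^ (2 * n) * TorusPAM.h d α ρ n t := by
      simp_rw [hpow]
      exact TorusPAM.summable_mul_h hρ hα hαd hDalang (by positivity) ht.le
    have hle : ∀ n : ℕ, ‖l ^ (2 * n) * TorusPAM.L d α ρ n t x₀ x x₀' x'‖ ≤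
        TorusPAM.heat₂ t x₀ x * TorusPAM.heat₂ t x₀' x' *
          ((l * C ^ (1 / 2 : ℝ)) ^ (2 * n) * TorusPAM.h d α ρ n t) := by
      intro n
      rw [norm_mul, pow_mul, Real.norm_of_nonneg (pow_nonneg hl2.le n), Real.norm_eq_abs, hpow]
      refine (mul_le_mul_of_nonneg_left (hL n t ht x₀ x x₀' x').1 (pow_nonneg hl2.le n)).trans_eq ?_
      rw [mul_pow]; ring
    have hmaj := hH.mul_left (TorusPAM.heat₂ t x₀ x * TorusPAM.heat₂ t x₀' x')
    refine ⟨Summable.of_norm_bounded hmaj hle, hH, ?_⟩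
    rw [TorusPAM.K, TorusPAM.H, ← tsum_mul_left, ← Real.norm_eq_abs]
    exact tsum_of_norm_bounded hmaj.hasSum hle
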